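/- **Setting.** Let $\mathcal X\subset\mathbb R^d$ be compact. For two groups $\ell=1,2$ and fixed covariates $x_{\ell,1},\dots,x_{\ell,k_\ell}\in\mathcal X$ (not depending on the sample sizes), observe $$Y_{\ell,i,j}=m_\ell(x_{\ell,i},\beta_\ell)+\eta_{\ell,i,j},\qquad j=1,\dots,n_{\ell,i},\ i=1,\dots,k_\ell ,$$ where all errors $\eta_{\ell,i,j}$ are independent and, within group $\ell$, identically distributed with mean $0$ and variance $\sigma_\ell^2\in(0,\infty)$. Put $n_\ell=\sum_i n_{\ell,i}$ and $n=n_1+n_2$. Limits are taken along a sequence of sample sizes with $n_1,n_2\to\infty$, $n_{\ell,i}/n_\ell\to\xi_{\ell,i}>0$ and $n/n_1\to\kappa\in(1,\infty)$. Suppose, for $\ell=1,2$: * The estimators $\hat\beta_\ell$ take values in a compact set $B_\ell\subset\mathbb R^{p_\ell}$ and $\beta_\ell$ is an interior point of $B_\ell$. * $b\mapsto m_\ell(x,b)$ is twice continuously differentiable in a neighbourhood of $\beta_\ell$ for all $x\in\mathcal X$, and $m_\ell$ and its first two derivatives with respect to $b$ exist and are continuous in $(x,b)$ on $\mathcal X\times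 B_\ell$. * For every $u>0$ there is $v>0$ with $\liminf\ \inf_{a,b\in B_\ell,\,|b-a|\ge u}\ \sum_i \frac{n_{\ell,i}}{n_\ell}\,(m_\ell(x_{\ell,i},a)-m_\ell(x_{\ell,i},b))^2\ge v$ (the infimum over the empty set being $+\infty$). * The matrix $\Sigma_\ell=\sigma_\ell^{-2}\sum_i\xi_{\ell,i}\,g_{\ell,i}\,g_{\ell,i}^\top$, with $g_{\ell,i}=\partial_b m_\ell(x_{\ell,i},b)|_{b=\beta_\ell}$, is non-singular. * $\sqrt{n_\ell}(\hat\beta_\ell-\beta_\ell)=n_\ell^{-1/2}\sum_i\sum_{j\le n_{\ell,i}}\phi_{\ell,i,j}+o_{\mathbb P}(1)$, where $\phi_{\ell,i,j}=\phi_{\ell,i}(Y_{\ell,i,j})$ for measurable functions $\phi_{\ell,i}:\mathbb R\to\mathbb R^{p_\ell}$, the $\phi_{\ell,i,j}$ are square integrable with mean $0$, and $\Sigma_\ell^{-1}=\sum_i\xi_{\ell,i}\,\mathbb E[\phi_{\ell,i,j}\phi_{\ell,i,j}^\top]$. * $\hat\sigma_\ell^2$ is a consistent estimator of $\sigma_\ell^2$.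 **Notation.** Let $\theta(x)=m_1(x,\beta_1)-m_2(x,\beta_2)$, $\hat\theta(x)=m_1(x,\hat\beta_1)-m_2(x,\hat\beta_2)$, $d_1=\int_{\mathcal X}|\theta(x)|\,dx$, $\hat d_1=\int_{\mathcal X}|\hat\theta(x)|\,dx$ and $\mathcal N=\{x\in\mathcal X:\theta(x)=0\}$. With independent standard normal vectors $Z_1,Z_2$ in $\mathbb R^{p_1},\mathbb R^{p_2}$ let $$G(x)=\big(\partial_b m_1(x,b)|_{b=\beta_1}\big)^{\!\top}\sqrt{\kappa}\,\Sigma_1^{-1/2}Z_1-\big(\partial_b m_2(x,b)|_{b=\beta_2}\big)^{\!\top}\sqrt{\tfrac{\kappa}{\kappa-1}}\,\Sigma_2^{-1/2}Z_2,$$ $$T=\int_{\mathcal X\setminus\mathcal N}\operatorname{sgn}(\theta(x))\,G(x)\,dx+\int_{\mathcal N}|G(x)|\,dx .$$ For a constant $c>0$ let $\hat{\mathcal N}=\{x\in\mathcal X:|\hat\theta(x)|<c\sqrt{\log n/n}\}$ and $$\hat\Sigma_\ell=\frac1{\hat\sigma_\ell^2}\sum_i\frac{n_{\ell,i}}{n_\ell}\,\hat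 g_{\ell,i}\,\hat g_{\ell,i}^\top,\qquad \hat g_{\ell,i}=\partial_b m_\ell(x_{\ell,i},b)|_{b=\hat\beta_\ell}.$$ Let $\hat G$ be $G$ with $\beta_\ell,\Sigma_\ell,\kappa$ replaced by $\hat\beta_\ell,\hat\Sigma_\ell,n/n_1$, and $$\hat T=\int_{\mathcal X\setminus\hat{\mathcal N}}\operatorname{sgn}(\hat\theta(x))\,\hat G(x)\,dx+\int_{\hat{\mathcal N}}|\hat G(x)|\,dx,$$ where $(Z_1,Z_2)$ is independent of the data. The $\alpha$-quantile of a distribution function $F$ is $\inf\{t:F(t)\ge\alpha\}$. For $\alpha\in(0,1)$ let $q_\alpha$ be the $\alpha$-quantile of the distribution function $F_T$ of $T$, and $\hat q_{0,\alpha}$ the $\alpha$-quantile of the conditional distribution of $\hat T$ given the data (that is, with the estimates held fixed). **Theorem 2.2.** Let $\alpha\in(0,1)$ and $c>0$. If $F_T$ is continuous at $q_\alpha$, then $$\lim_{n\to\infty}\mathbb P\Big(d_1\in\Big[0,\ \hat d_1-\frac{\hat q_{0,\alpha}}{\sqrt n}\Big)\Big)=1-\alpha .$$ Moreover, for every $\varepsilon>0$: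 1. If $d_1\ge\varepsilon$ (and, when $d_1=\varepsilon$, $F_T$ is continuous at $q_\alpha$), then $\displaystyle\limsup_{n\to\infty}\mathbb P\Big(\hat d_1<\varepsilon+\frac{\hat q_{0,\alpha}}{\sqrt n}\Big)\le\alpha$. 2. If $d_1<\varepsilon$, then $\displaystyle\liminf_{n\to\infty}\mathbb P\Big(\hat d_1<\varepsilon+\frac{\hat q_{0,\alpha}}{\sqrt n}\Big)=1$. -/

import Mathlib

open MeasureTheory ProbabilityTheory Filter Topology
open scoped Gradient MatrixOrder

noncomputable section

abbrev Euc (n : ℕ) := EuclideanSpace ℝ (Fin n)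

/-- The `α`-quantile `inf {t : F(t) ≥ α}` of a probability measure on the real line
with distribution function `F`. -/
def quantile (P : Measure ℝ) (α : ℝ) : ℝ := sInf {t : ℝ | α ≤ cdf P t}

/-- The area `∫_X |m₁(x, b₁) - m₂(x, b₂)| dx` between two regression curves. -/
def areaBetween {d p₁ p₂ : ℕ} (X : Set (Euc d)) (m₁ : Euc d → Euc p₁ → ℝ)
    (m₂ : Euc d → Euc p₂ → ℝ) (b₁ : Euc p₁) (b₂ : Euc p₂) : ℝ :=
  ∫ x in X, |m₁ x b₁ - m₂ x b₂|

/-- `v⁻¹ ∑ᵢ wᵢ (∂m(xᵢ, b)/∂b) (∂m(xᵢ, b)/∂b)ᵀ`. -/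
def infoMatrix {d p k : ℕ} (m : Euc d → Euc p → ℝ) (x : Fin k → Euc d) (w : Fin k → ℝ)
    (b : Euc p) (v : ℝ) : Matrix (Fin p) (Fin p) ℝ :=
  v⁻¹ • ∑ i, w i • Matrix.vecMulVec (WithLp.ofLp (∇ (m (x i)) b)) (WithLp.ofLp (∇ (m (x i)) b))

/-- The value at `x` of the process
`(∂m₁(x, b₁)/∂b₁)ᵀ √κ S₁^{-1/2} z₁ - (∂m₂(x, b₂)/∂b₂)ᵀ √(κ/(κ-1)) S₂^{-1/2} z₂`. -/
def gaussProcess {d p₁ p₂ : ℕ} (m₁ : Euc d → Euc p₁ → ℝ) (m₂ : Euc d → Euc p₂ → ℝ)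
    (b₁ : Euc p₁) (b₂ : Euc p₂) (S₁ : Matrix (Fin p₁) (Fin p₁) ℝ)
    (S₂ : Matrix (Fin p₂) (Fin p₂) ℝ) (κ : ℝ) (z : Euc p₁ × Euc p₂) (x : Euc d) : ℝ :=
  inner ℝ (∇ (m₁ x) b₁) (√κ • Matrix.toEuclideanCLM (𝕜 := ℝ) (CFC.sqrt S₁⁻¹) z.1)
    - inner ℝ (∇ (m₂ x) b₂)
        (√(κ / (κ - 1)) • Matrix.toEuclideanCLM (𝕜 := ℝ) (CFC.sqrt S₂⁻¹) z.2)

/-- `∫_{X \ A} sgn(θ(x)) g(x) dx + ∫_A |g(x)| dx`. -/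
def signedArea {d : ℕ} (X A : Set (Euc d)) (θ g : Euc d → ℝ) : ℝ :=
  (∫ x in X \ A, Real.sign (θ x) * g x) + ∫ x in A, |g x|

/-- The data of a two-sample nonlinear regression experiment observed along a sequence of
stages `ν = 0, 1, 2, …`, the group being `ℓ : Fin 2`. No property is imposed here: the model
assumptions are collected in `TwoSample.Assumptions`. -/
structure TwoSample (Ω : Type*) (d : ℕ) (p k : Fin 2 → ℕ) where
  /-- the covariate region -/
  X : Set (Euc d)
  /-- the regression functions `m_ℓ(x, b)` -/
  m : (ℓ : Fin 2) → Euc d → Euc (p ℓ) → ℝ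
  /-- the parameter sets -/
  B : (ℓ : Fin 2) → Set (Euc (p ℓ))
  /-- the true parameters -/
  β : (ℓ : Fin 2) → Euc (p ℓ)
  /-- the error standard deviations -/
  σ : Fin 2 → ℝ
  /-- the covariates `x_{ℓ,i}` at which observations are taken -/
  x : (ℓ : Fin 2) → Fin (k ℓ) → Euc d
  /-- the errors `η_{ℓ,i,j}`, of which only those with `j < num ℓ i ν` enter at stage `ν` -/
  η : (ℓ : Fin 2) → Fin (k ℓ) → ℕ → Ω → ℝ
  /-- the number `n_{ℓ,i}` of observations at covariate `x_{ℓ,i}`, at stage `ν` -/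
  num : (ℓ : Fin 2) → Fin (k ℓ) → ℕ → ℕ
  /-- the limits of `n_{ℓ,i} / n_ℓ` -/
  ξ : (ℓ : Fin 2) → Fin (k ℓ) → ℝ
  /-- the limit of `n / n₁` -/
  κ : ℝ
  /-- the estimators of the parameters, at stage `ν` -/
  βHat : (ℓ : Fin 2) → ℕ → Ω → Euc (p ℓ)
  /-- the estimators of the error variances, at stage `ν` -/
  σSqHat : Fin 2 → ℕ → Ω → ℝ

namespace TwoSample

variable {Ω : Type*} {d : ℕ} {p k : Fin 2 → ℕ} (R : TwoSample Ω d p k)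

/-- The observations `Y_{ℓ,i,j} = m_ℓ(x_{ℓ,i}, β_ℓ) + η_{ℓ,i,j}`. -/
def Y (ℓ : Fin 2) (i : Fin (k ℓ)) (j : ℕ) (ω : Ω) : ℝ :=
  R.m ℓ (R.x ℓ i) (R.β ℓ) + R.η ℓ i j ω

/-- The sample size `n_ℓ` of group `ℓ`, at stage `ν`. -/
def size (ℓ : Fin 2) (ν : ℕ) : ℕ := ∑ i, R.num ℓ i ν

/-- The total sample size `n`, at stage `ν`. -/
def total (ν : ℕ) : ℕ := R.size 0 ν + R.size 1 ν

/-- The matrices `Σ_ℓ`. -/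
def infoTrue (ℓ : Fin 2) : Matrix (Fin (p ℓ)) (Fin (p ℓ)) ℝ :=
  infoMatrix (R.m ℓ) (R.x ℓ) (R.ξ ℓ) (R.β ℓ) (R.σ ℓ ^ 2)

/-- The estimators of the matrices `Σ_ℓ`. -/
def infoHat (ℓ : Fin 2) (ν : ℕ) (ω : Ω) : Matrix (Fin (p ℓ)) (Fin (p ℓ)) ℝ :=
  infoMatrix (R.m ℓ) (R.x ℓ) (fun i => (R.num ℓ i ν : ℝ) / R.size ℓ ν) (R.βHat ℓ ν ω)
    (R.σSqHat ℓ ν ω)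

/-- The `L¹`-distance `d₁` between the two regression curves. -/
def dist : ℝ := areaBetween R.X (R.m 0) (R.m 1) (R.β 0) (R.β 1)

/-- The plug-in estimator of `d₁`. -/
def distHat (ν : ℕ) (ω : Ω) : ℝ :=
  areaBetween R.X (R.m 0) (R.m 1) (R.βHat 0 ν ω) (R.βHat 1 ν ω)

/-- The difference of the regression curves. -/
def θ (x : Euc d) : ℝ := R.m 0 x (R.β 0) - R.m 1 x (R.β 1)

/-- The difference of the estimated regression curves. -/
def θHat (ν : ℕ) (ω : Ω) (x : Euc d) : ℝ :=
  R.m 0 x (R.βHat 0 ν ω) - R.m 1 x (R.βHat 1 ν ω)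

/-- The set where the two regression curves coincide. -/
def zeroSet : Set (Euc d) := {x ∈ R.X | R.θ x = 0}

/-- The thresholded estimator of the set where the two regression curves coincide. -/
def zeroSetHat (c : ℝ) (ν : ℕ) (ω : Ω) : Set (Euc d) :=
  {x ∈ R.X | |R.θHat ν ω x| < c * √(Real.log (R.total ν) / R.total ν)}

/-- The limit variable `T` as a function of the pair `(Z₁, Z₂)` of standard normal vectors. -/
def T (z : Euc (p 0) × Euc (p 1)) : ℝ :=
  signedArea R.X R.zeroSet R.θ
    (gaussProcess (R.m 0) (R.m 1) (R.β 0) (R.β 1) (R.infoTrue 0) (R.infoTrue 1) R.κ z)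

/-- The plug-in version of `T` given the data, as a function of the pair of standard normal
vectors. -/
def THat (c : ℝ) (ν : ℕ) (ω : Ω) (z : Euc (p 0) × Euc (p 1)) : ℝ :=
  signedArea R.X (R.zeroSetHat c ν ω) (R.θHat ν ω)
    (gaussProcess (R.m 0) (R.m 1) (R.βHat 0 ν ω) (R.βHat 1 ν ω) (R.infoHat 0 ν ω)
      (R.infoHat 1 ν ω) ((R.total ν : ℝ) / R.size 0 ν) z)

/-- The distribution of `T`, where `Z₁` and `Z₂` are independent standard normal vectors. -/
def lawT : Measure ℝ := ((stdGaussian (Euc (p 0))).prod (stdGaussian (Euc (p 1)))).map R.T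

/-- The conditional distribution of the plug-in version of `T` given the data: the estimates
are fixed at their observed values and the standard normal vectors are independent of them. -/
def lawTHat (c : ℝ) (ν : ℕ) (ω : Ω) : Measure ℝ :=
  ((stdGaussian (Euc (p 0))).prod (stdGaussian (Euc (p 1)))).map (R.THat c ν ω)

/-- The conditional `α`-quantile of the plug-in version of `T` given the data. -/
def qHat (c α : ℝ) (ν : ℕ) (ω : Ω) : ℝ := quantile (R.lawTHat c ν ω) α

/-- The confidence interval for `d₁`. -/
def confInterval (c α : ℝ) (ν : ℕ) (ω : Ω) : Set ℝ :=
  Set.Ico 0 (R.distHat ν ω - R.qHat c α ν ω / √(R.total ν))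

/-- The event that the test rejects the hypothesis `d₁ ≥ ε`. -/
def rejects (c α ε : ℝ) (ν : ℕ) : Set Ω :=
  {ω | R.distHat ν ω < ε + R.qHat c α ν ω / √(R.total ν)}

/-- The assumptions on the model and on the estimators. -/
structure Assumptions [MeasurableSpace Ω] (μ : Measure Ω) : Prop where
  /-- all errors of both groups are independent -/
  indep : iIndepFun (fun (t : (ℓ : Fin 2) × Fin (k ℓ) × ℕ) => R.η t.1 t.2.1 t.2.2) μ
  measurable_error : ∀ ℓ i j, Measurable (R.η ℓ i j)
  /-- within a group the errors are identically distributed -/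
  ident : ∀ ℓ i j i' j', IdentDistrib (R.η ℓ i j) (R.η ℓ i' j') μ μ
  memLp_error : ∀ ℓ i j, MemLp (R.η ℓ i j) 2 μ
  mean_error : ∀ ℓ i j, ∫ ω, R.η ℓ i j ω ∂μ = 0
  sigma_pos : ∀ ℓ, 0 < R.σ ℓ
  var_error : ∀ ℓ i j, variance (R.η ℓ i j) μ = R.σ ℓ ^ 2
  compact_region : IsCompact R.X
  covariate_mem : ∀ ℓ i, R.x ℓ i ∈ R.X
  compact_param : ∀ ℓ, IsCompact (R.B ℓ)
  true_param_mem : ∀ ℓ, R.β ℓ ∈ interior (R.B ℓ)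
  measurable_estimator : ∀ ℓ ν, Measurable (R.βHat ℓ ν)
  estimator_mem : ∀ ℓ ν ω, R.βHat ℓ ν ω ∈ R.B ℓ
  /-- twice continuous differentiability in the parameter near the true parameter -/
  smooth : ∀ ℓ, ∃ U : Set (Euc (p ℓ)), IsOpen U ∧ R.β ℓ ∈ U ∧
    ∀ x ∈ R.X, ContDiffOn ℝ 2 (R.m ℓ x) U
  differentiable : ∀ ℓ, ∀ x ∈ R.X, ∀ b ∈ R.B ℓ,
    DifferentiableAt ℝ (R.m ℓ x) b ∧ DifferentiableAt ℝ (fderiv ℝ (R.m ℓ x)) b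
  continuous : ∀ ℓ, ContinuousOn (fun q : Euc d × Euc (p ℓ) => R.m ℓ q.1 q.2) (R.X ×ˢ R.B ℓ)
  continuous_deriv : ∀ ℓ, ContinuousOn
    (fun q : Euc d × Euc (p ℓ) => fderiv ℝ (R.m ℓ q.1) q.2) (R.X ×ˢ R.B ℓ)
  continuous_deriv_two : ∀ ℓ, ContinuousOn
    (fun q : Euc d × Euc (p ℓ) => fderiv ℝ (fderiv ℝ (R.m ℓ q.1)) q.2) (R.X ×ˢ R.B ℓ)
  /-- the parameters are uniformly identifiable from the regression function at the covariates:
  for every `u > 0` the lower limit of the infimum over `|b - a| ≥ u` is bounded away from zero -/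
  identifiable : ∀ ℓ, ∀ u > 0, ∃ v > 0, ∀ᶠ ν in atTop, ∀ a ∈ R.B ℓ, ∀ b ∈ R.B ℓ, u ≤ ‖b - a‖ →
    v ≤ ∑ i, (R.num ℓ i ν : ℝ) / R.size ℓ ν * (R.m ℓ (R.x ℓ i) a - R.m ℓ (R.x ℓ i) b) ^ 2
  info_nonsingular : ∀ ℓ, IsUnit (R.infoTrue ℓ).det
  size_tendsto : ∀ ℓ, Tendsto (R.size ℓ) atTop atTop
  ξ_pos : ∀ ℓ i, 0 < R.ξ ℓ i
  weight_tendsto : ∀ ℓ i,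
    Tendsto (fun ν => (R.num ℓ i ν : ℝ) / R.size ℓ ν) atTop (𝓝 (R.ξ ℓ i))
  one_lt_κ : 1 < R.κ
  ratio_tendsto : Tendsto (fun ν => (R.total ν : ℝ) / R.size 0 ν) atTop (𝓝 R.κ)
  /-- the estimators are asymptotically linear with centred, square integrable influence
  functions `φ_{ℓ,i}` applied to the observations, and their asymptotic covariance matrix is
  the inverse of `Σ_ℓ` -/
  linearization : ∀ ℓ, ∃ φ : Fin (k ℓ) → ℝ → Euc (p ℓ),
    (∀ i, Measurable (φ i)) ∧
    (∀ i j, MemLp (fun ω => φ i (R.Y ℓ i j ω)) 2 μ) ∧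
    (∀ i j, ∫ ω, φ i (R.Y ℓ i j ω) ∂μ = 0) ∧
    (∀ j, (R.infoTrue ℓ)⁻¹ = ∑ i, R.ξ ℓ i •
      Matrix.of fun r s => ∫ ω, φ i (R.Y ℓ i j ω) r * φ i (R.Y ℓ i j ω) s ∂μ) ∧
    TendstoInMeasure μ
      (fun ν ω => √(R.size ℓ ν) • (R.βHat ℓ ν ω - R.β ℓ)
        - (√(R.size ℓ ν))⁻¹ • ∑ i, ∑ j ∈ Finset.range (R.num ℓ i ν), φ i (R.Y ℓ i j ω))
      atTop (fun _ => 0)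
  measurable_variance : ∀ ℓ ν, Measurable (R.σSqHat ℓ ν)
  variance_consistent : ∀ ℓ,
    TendstoInMeasure μ (R.σSqHat ℓ) atTop (fun _ => R.σ ℓ ^ 2)

end TwoSample

end

/-!
# Asymptotic validity of inference for the area between two regression curves

Write `w ↦ D(w)` for the directional derivative `dirDeriv` of the area `d₁` at the true parameters,
that is `D(w) = ∫_{X \ N} sgn(θ) g_w + ∫_N |g_w|` with `g_w` (`tangent`) the derivative of the
difference of the curves in the direction `w`. The theorem rests on three facts.

* The rescaled errors `W = √n (β̂ - β)` of both groups converge jointly to the Gaussian vector `G`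
  for which `T = D(G)` (`tendstoInDistribution_scaledError`). The linearized errors are weighted
  sums over finitely many independent samples, whose characteristic functions converge by a
  second order expansion (`tendsto_charFun_sum_samples`); Lévy's theorem and Slutsky's lemma do the
  rest.
* `√n (d̂₁ - d₁) = D(W) + o_P(1)` (`tendsto_smul_distHat_sub`), because the `L¹`-norm is
  directionally differentiable: the sign of `θ` is unaffected by a perturbation of order `n^{-1/2}`
  except on a set `{0 < |θ| < K / √n}` of vanishing volume.
* The conditional quantiles are consistent (`tendsto_qHat`). The threshold `c √(log n / n)` tends to
  zero but dominates the error of `θ̂`, so `|T̂(z) - T(z)| ≤ δ ‖z‖` for all `z` at once, with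
  probability tending to one (`eventually_abs_THat_sub_le`). Moreover `F_T` is strictly increasing
  where it lies strictly between zero and one, since `T` is a continuous function of a vector with
  full support (`lt_cdf_map_of_quantile_lt`), so its quantiles are stable.

Coverage, and rejection when `d₁ = ε`, amount to comparing `√n (d̂₁ - d₁)` with the conditional
quantile, and the portmanteau theorem gives the limits of the probabilities; when `d₁ ≠ ε`,
consistency of `d̂₁` decides. Measurability of the conditional quantile is never
needed: all statements in probability are phrased with the filter `inProb` of those events whose
complements have vanishing outer probability, and limits along it follow from the usual calculus of
limits. Bounded rescaled errors may be assumed there (`StochBounded.tendsto_inProb`), which turns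
the expansions above into deterministic statements.
-/

noncomputable section

open scoped Matrix

/-! ### Convergence in probability along a filter, for events that need not be measurable -/

/-- The filter on `ℕ × Ω` of the events whose complements have outer probability tending to zero
along the stages. -/
def inProb {Ω : Type*} [MeasurableSpace Ω] (μ : Measure Ω) : Filter (ℕ × Ω) where
  sets := {S | Tendsto (fun ν => μ {ω | (ν, ω) ∉ S}) atTop (𝓝 0)}
  univ_sets := by simp
  sets_of_superset := by
    intro S S' hS hSS
    exact tendsto_of_tendsto_of_tendsto_of_le_of_le tendsto_const_nhds hS (fun _ => zero_le)
      (fun ν => measure_mono fun ω hω h => hω (hSS h))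
  inter_sets := by
    intro S S' hS hS'
    have := Tendsto.add hS hS'
    rw [add_zero] at this
    refine tendsto_of_tendsto_of_tendsto_of_le_of_le tendsto_const_nhds this (fun _ => zero_le)
      (fun ν => (measure_mono ?_).trans (measure_union_le _ _))
    intro ω hω
    by_contra h
    simp only [Set.mem_union, Set.mem_ofPred_eq, not_or, not_not] at h
    exact hω h

section InProb

variable {Ω : Type*} [MeasurableSpace Ω] {μ : Measure Ω}

lemma eventually_inProb {q : ℕ × Ω → Prop} :
    (∀ᶠ t in inProb μ, q t) ↔ Tendsto (fun ν => μ {ω | ¬ q (ν, ω)}) atTop (𝓝 0) := Iff.rfl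

lemma tendsto_fst_inProb : Tendsto Prod.fst (inProb μ) atTop := by
  refine tendsto_atTop.2 fun N => eventually_inProb.2 ?_
  refine tendsto_const_nhds.congr' ?_
  filter_upwards [eventually_ge_atTop N] with ν hν
  simp [hν]

lemma MeasureTheory.TendstoInMeasure.tendsto_inProb {E : Type*} [PseudoEMetricSpace E]
    {f : ℕ → Ω → E} {a : E} (h : TendstoInMeasure μ f atTop (fun _ => a)) :
    Tendsto (fun t : ℕ × Ω => f t.1 t.2) (inProb μ) (𝓝 a) := by
  rw [Metric.nhds_basis_eball.tendsto_right_iff]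
  intro ε hε
  refine eventually_inProb.2 ?_
  simpa using! h ε hε

lemma tendstoInMeasure_of_tendsto_inProb {E : Type*} [PseudoEMetricSpace E]
    {f : ℕ → Ω → E} {a : E} (h : Tendsto (fun t : ℕ × Ω => f t.1 t.2) (inProb μ) (𝓝 a)) :
    TendstoInMeasure μ f atTop (fun _ => a) := by
  rw [Metric.nhds_basis_eball.tendsto_right_iff] at h
  intro ε hε
  simpa using! eventually_inProb.1 (h ε hε)

/-- Stochastic boundedness (tightness) of a sequence of random vectors. -/
def StochBounded {E : Type*} [Norm E] (μ : Measure Ω) (W : ℕ → Ω → E) : Prop :=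
  ∀ ε : ENNReal, 0 < ε → ∃ M : ℝ, ∀ᶠ ν in atTop, μ {ω | M < ‖W ν ω‖} ≤ ε

/-- A limit in probability may be checked on the events on which a stochastically bounded sequence
is bounded by a constant; on these the argument is deterministic. -/
lemma StochBounded.tendsto_inProb {E : Type*} [Norm E] {W : ℕ → Ω → E} (hW : StochBounded μ W)
    {F : Type*} {f : ℕ × Ω → F} {l : Filter F}
    (h : ∀ M : ℝ, Tendsto f (inProb μ ⊓ 𝓟 {t | ‖W t.1 t.2‖ ≤ M}) l) : Tendsto f (inProb μ) l := by
  intro S hS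
  refine eventually_inProb.2 (ENNReal.tendsto_nhds_zero.2 fun ε hε => ?_)
  obtain ⟨M, hM⟩ := hW (ε / 2) (ENNReal.half_pos hε.ne')
  have h1 : ∀ᶠ t in inProb μ, ‖W t.1 t.2‖ ≤ M → f t ∈ S := eventually_inf_principal.1 (h M hS)
  have h2 := ENNReal.tendsto_nhds_zero.1 (eventually_inProb.1 h1) (ε / 2) (ENNReal.half_pos hε.ne')
  filter_upwards [hM, h2] with ν h3 h4
  rw [← ENNReal.add_halves ε]
  refine (measure_mono ?_).trans ((measure_union_le _ _).trans (add_le_add h3 h4))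
  intro ω hω
  by_cases hc : M < ‖W ν ω‖
  · exact Or.inl hc
  · exact Or.inr fun h => hω (h (not_lt.1 hc))

/-- The portmanteau bound for events that are, up to an event of vanishing outer probability,
contained in the preimage of a closed set. The events need not be measurable. -/
lemma MeasureTheory.TendstoInDistribution.eventually_measureReal_le [IsProbabilityMeasure μ]
    {Ω' : Type*} [MeasurableSpace Ω'] {γ : Measure Ω'} [IsProbabilityMeasure γ]
    {E : Type*} [PseudoEMetricSpace E] [MeasurableSpace E] [BorelSpace E]
    {S : ℕ → Ω → E} {Z : Ω' → E}
    (hS : TendstoInDistribution S atTop Z (fun _ => μ) γ) {C : Set E} (hC : IsClosed C)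
    {A : ℕ → Set Ω} (hA : ∀ᶠ t in inProb μ, t.2 ∈ A t.1 → S t.1 t.2 ∈ C) {ε : ℝ} (hε : 0 < ε) :
    ∀ᶠ ν in atTop, μ.real (A ν) ≤ (γ.map Z).real C + ε := by
  have h1 := ProbabilityMeasure.limsup_measure_closed_le_of_tendsto hS.tendsto hC
  have hZ := hS.aemeasurable_limit
  have : IsProbabilityMeasure (γ.map Z) := Measure.isProbabilityMeasure_map hZ
  have hlt : (γ.map Z) C < ENNReal.ofReal ((γ.map Z).real C + ε / 2) := by
    rw [← ENNReal.ofReal_toReal (measure_ne_top (γ.map Z) C)]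
    exact (ENNReal.ofReal_lt_ofReal_iff (by positivity)).2 (by unfold Measure.real; linarith)
  have h2 := eventually_lt_of_limsup_lt (h1.trans_lt hlt)
  have h3 := ENNReal.tendsto_nhds_zero.1 (eventually_inProb.1 hA) (ENNReal.ofReal (ε / 2))
    (by simpa using hε)
  filter_upwards [h2, h3] with ν h4 h5
  have h6 : μ (A ν) ≤ ENNReal.ofReal ((γ.map Z).real C + ε / 2) + ENNReal.ofReal (ε / 2) := by
    have h7 : μ (S ν ⁻¹' C) ≤ ENNReal.ofReal ((γ.map Z).real C + ε / 2) := by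
      simp only [ProbabilityMeasure.coe_mk] at h4
      rw [Measure.map_apply_of_aemeasurable (hS.forall_aemeasurable ν) hC.measurableSet] at h4
      exact h4.le
    refine (measure_mono ?_).trans ((measure_union_le _ _).trans (add_le_add h7 h5))
    intro ω hω
    by_cases hc : S ν ω ∈ C
    · exact Or.inl hc
    · exact Or.inr fun h => hc (h hω)
  rw [← ENNReal.ofReal_add (by positivity) (by positivity)] at h6
  have h8 := ENNReal.toReal_mono ENNReal.ofReal_ne_top h6
  rw [ENNReal.toReal_ofReal (by positivity)] at h8
  simp only [Measure.real] at h8 ⊢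
  linarith

lemma tendsto_measure_norm_ge {E : Type*} [NormedAddCommGroup E] [MeasurableSpace E] [BorelSpace E]
    (P : Measure E) [IsFiniteMeasure P] :
    Tendsto (fun M : ℕ => P {w | (M : ℝ) ≤ ‖w‖}) atTop (𝓝 0) := by
  have h1 : Tendsto (fun M : ℕ => P {w | (M : ℝ) ≤ ‖w‖}) atTop
      (𝓝 (P (⋂ M : ℕ, {w | (M : ℝ) ≤ ‖w‖}))) := by
    refine tendsto_measure_iInter_atTop (fun M => ?_) ?_ ⟨0, measure_ne_top _ _⟩
    · exact (isClosed_le continuous_const continuous_norm).measurableSet.nullMeasurableSet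
    · intro M M' hM w hw
      have hMM : (M : ℝ) ≤ M' := by exact_mod_cast hM
      simp only [Set.mem_ofPred_eq] at hw ⊢
      exact hMM.trans hw
  have h2 : (⋂ M : ℕ, {w : E | (M : ℝ) ≤ ‖w‖}) = ∅ := by
    ext w
    obtain ⟨M, hM⟩ := exists_nat_gt ‖w‖
    simp only [Set.mem_iInter, Set.mem_ofPred_eq, Set.mem_empty_iff_false, iff_false, not_forall,
      not_le]
    exact ⟨M, hM⟩
  rwa [h2, measure_empty] at h1

/-- Sequences converging in distribution are stochastically bounded. -/
lemma MeasureTheory.TendstoInDistribution.stochBounded [IsProbabilityMeasure μ]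
    {Ω' : Type*} [MeasurableSpace Ω'] {γ : Measure Ω'} [IsProbabilityMeasure γ]
    {E : Type*} [NormedAddCommGroup E] [MeasurableSpace E] [BorelSpace E]
    {S : ℕ → Ω → E} {Z : Ω' → E}
    (hS : TendstoInDistribution S atTop Z (fun _ => μ) γ) : StochBounded μ S := by
  intro ε hε
  have hZ := hS.aemeasurable_limit
  have : IsProbabilityMeasure (γ.map Z) := Measure.isProbabilityMeasure_map hZ
  obtain ⟨δ, hδ, hδε⟩ : ∃ δ : ℝ, 0 < δ ∧ ENNReal.ofReal δ ≤ ε := by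
    by_cases h : ε = ⊤
    · exact ⟨1, one_pos, by simp [h]⟩
    · exact ⟨ε.toReal, ENNReal.toReal_pos hε.ne' h, by rw [ENNReal.ofReal_toReal h]⟩
  have h1 := tendsto_measure_norm_ge (γ.map Z)
  obtain ⟨M, hM⟩ := (ENNReal.tendsto_nhds_zero.1 h1 (ENNReal.ofReal (δ / 2))
    (by simpa using hδ)).exists
  refine ⟨M, ?_⟩
  have h3 := hS.eventually_measureReal_le (A := fun ν => {ω | (M : ℝ) < ‖S ν ω‖})
    (isClosed_le (continuous_const (y := (M : ℝ))) continuous_norm)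
    (Eventually.of_forall fun t ht => by
      simp only [Set.mem_ofPred_eq] at ht ⊢
      exact ht.le) (half_pos hδ)
  filter_upwards [h3] with ν h4
  refine le_trans ?_ hδε
  rw [← ENNReal.ofReal_toReal (measure_ne_top μ _)]
  refine ENNReal.ofReal_le_ofReal (h4.trans ?_)
  have := ENNReal.toReal_mono ENNReal.ofReal_ne_top hM
  rw [ENNReal.toReal_ofReal (by positivity)] at this
  simp only [Measure.real] at this ⊢
  linarith

end InProb

/-! ### Square roots of positive semidefinite matrices -/

/-- The positive square root depends continuously on a positive semidefinite matrix: the roots stay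
in a compact set because their squared entries are bounded by the diagonal of the matrix, and the
root of the limit is the only possible cluster point. -/
lemma Matrix.PosSemidef.tendsto_sqrt {ι : Type*} {l : Filter ι} {n : ℕ}
    {A : ι → Matrix (Fin n) (Fin n) ℝ} {A₀ : Matrix (Fin n) (Fin n) ℝ}
    (hA : ∀ᶠ i in l, (A i).PosSemidef) (hA₀ : A₀.PosSemidef) (h : Tendsto A l (𝓝 A₀)) :
    Tendsto (fun i => CFC.sqrt (A i)) l (𝓝 (CFC.sqrt A₀)) := by
  have hcomp : IsCompact (Set.univ.pi fun r : Fin n => Set.univ.pi fun _ : Fin n =>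
      Set.Icc (-√(A₀ r r + 1)) (√(A₀ r r + 1))) :=
    isCompact_univ_pi fun r => isCompact_univ_pi fun s => isCompact_Icc
  have hdiag : ∀ᶠ i in l, ∀ r, A i r r ≤ A₀ r r + 1 := by
    refine eventually_all.2 fun r => ?_
    have h1 : Tendsto (fun i => A i r r) l (𝓝 (A₀ r r)) :=
      tendsto_pi_nhds.1 (tendsto_pi_nhds.1 h r) r
    exact (h1.eventually_lt_const (by linarith)).mono fun _ hi => hi.le
  refine hcomp.tendsto_nhds_of_unique_mapClusterPt ?_ ?_
  · filter_upwards [hA, hdiag] with i hi hd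
    intro r _ s _
    have hS := Matrix.nonneg_iff_posSemidef.1 (CFC.sqrt_nonneg (A i))
    have hSS : CFC.sqrt (A i) * CFC.sqrt (A i) = A i := CFC.sqrt_mul_sqrt_self (A i) hi.nonneg
    have h1 : A i r r = ∑ t, CFC.sqrt (A i) r t ^ 2 := by
      conv_lhs => rw [← hSS]
      rw [Matrix.mul_apply]
      refine Finset.sum_congr rfl fun t _ => ?_
      have := hS.isHermitian.apply t r
      simp only [star_trivial] at this
      rw [sq, this]
    have h2 : CFC.sqrt (A i) r s ^ 2 ≤ A₀ r r + 1 := by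
      refine le_trans ?_ (hd r)
      rw [h1]
      exact Finset.single_le_sum (f := fun t => CFC.sqrt (A i) r t ^ 2)
        (fun t _ => sq_nonneg _) (Finset.mem_univ s)
    exact abs_le.1 (Real.abs_le_sqrt h2)
  · intro (B : Matrix (Fin n) (Fin n) ℝ) _ hB
    obtain ⟨U, hUl, hU⟩ := mapClusterPt_iff_ultrafilter.1 hB
    have hclosed : IsClosed {C : Matrix (Fin n) (Fin n) ℝ | C.PosSemidef} := by
      simp only [Matrix.posSemidef_iff_dotProduct_mulVec, Set.ofPred_and, Set.ofPred_forall]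
      refine IsClosed.inter (isClosed_eq (by fun_prop) (by fun_prop)) (isClosed_iInter fun x => ?_)
      exact isClosed_le (by fun_prop) (by fun_prop)
    have hBpsd : B.PosSemidef :=
      hclosed.mem_of_tendsto hU (Eventually.of_forall fun i =>
        Matrix.nonneg_iff_posSemidef.1 (CFC.sqrt_nonneg (A i)))
    have hBB : B * B = A₀ := by
      have h1 : Tendsto (fun i => CFC.sqrt (A i) * CFC.sqrt (A i)) U (𝓝 (B * B)) :=
        (show Tendsto (fun i => CFC.sqrt (A i)) U (𝓝 B) from hU).mul
          (show Tendsto (fun i => CFC.sqrt (A i)) U (𝓝 B) from hU)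
      refine tendsto_nhds_unique h1 ((h.mono_left hUl).congr' ?_)
      filter_upwards [hUl hA] with i hi
      exact (CFC.sqrt_mul_sqrt_self (A i) hi.nonneg).symm
    exact ((CFC.sqrt_eq_iff A₀ B hA₀.nonneg hBpsd.nonneg).2 hBB).symm

/-! ### Quantiles of functions of a Gaussian vector -/

instance isOpenPosMeasure_gaussianReal_zero_one :
    (gaussianReal 0 1).IsOpenPosMeasure :=
  (gaussianReal_absolutelyContinuous' 0 one_ne_zero).isOpenPosMeasure

instance isOpenPosMeasure_stdGaussian_euc (n : ℕ) :
    (stdGaussian (Euc n)).IsOpenPosMeasure := by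
  rw [← map_pi_eq_stdGaussian]
  exact (PiLp.continuous_toLp 2 _).isOpenPosMeasure_map (WithLp.toLp_surjective 2)

section Quantile

lemma quantile_bddBelow (P : Measure ℝ) {α : ℝ} (h₀ : 0 < α) :
    BddBelow {t : ℝ | α ≤ cdf P t} := by
  obtain ⟨t, ht⟩ := ((tendsto_cdf_atBot P).eventually_lt_const h₀).exists
  refine ⟨t, fun s hs => ?_⟩
  by_contra hlt
  exact absurd (hs.trans (monotone_cdf P (not_le.1 hlt).le)) (not_le.2 ht)

lemma quantile_nonempty (P : Measure ℝ) {α : ℝ} (h₁ : α < 1) :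
    {t : ℝ | α ≤ cdf P t}.Nonempty := by
  obtain ⟨t, ht⟩ := ((tendsto_cdf_atTop P).eventually_const_lt h₁).exists
  exact ⟨t, ht.le⟩

lemma cdf_lt_of_lt_quantile {P : Measure ℝ} {α t : ℝ} (h₀ : 0 < α) (ht : t < quantile P α) :
    cdf P t < α :=
  not_le.1 fun h => absurd (csInf_le (quantile_bddBelow P h₀) h) (not_le.2 ht)

lemma le_cdf_of_quantile_lt {P : Measure ℝ} {α t : ℝ} (h₁ : α < 1) (ht : quantile P α < t) :
    α ≤ cdf P t := by
  obtain ⟨s, hs, hst⟩ := exists_lt_of_csInf_lt (quantile_nonempty P h₁) ht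
  exact le_trans hs (monotone_cdf P hst.le)

lemma quantile_le {P : Measure ℝ} {α t : ℝ} (h₀ : 0 < α) (ht : α ≤ cdf P t) :
    quantile P α ≤ t := csInf_le (quantile_bddBelow P h₀) ht

lemma le_quantile {P : Measure ℝ} {α t : ℝ} (h₁ : α < 1) (ht : cdf P t < α) :
    t ≤ quantile P α := by
  refine le_csInf (quantile_nonempty P h₁) fun s hs => ?_
  by_contra hlt
  exact absurd (le_trans hs (monotone_cdf P (not_le.1 hlt).le)) (not_le.2 ht)

lemma cdf_quantile_of_continuousAt {P : Measure ℝ} {α : ℝ} (h₀ : 0 < α) (h₁ : α < 1)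
    (hc : ContinuousAt (cdf P) (quantile P α)) : cdf P (quantile P α) = α := by
  apply le_antisymm
  · refine le_of_tendsto
      (hc.tendsto.mono_left (nhdsWithin_le_nhds (s := Set.Iio (quantile P α)))) ?_
    filter_upwards [self_mem_nhdsWithin] with t ht
    exact (cdf_lt_of_lt_quantile h₀ ht).le
  · refine ge_of_tendsto
      (hc.tendsto.mono_left (nhdsWithin_le_nhds (s := Set.Ioi (quantile P α)))) ?_
    filter_upwards [self_mem_nhdsWithin] with t ht
    exact le_cdf_of_quantile_lt h₁ ht

lemma cdf_map {V : Type*} [MeasurableSpace V] {γ : Measure V} [IsProbabilityMeasure γ]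
    {T : V → ℝ} (hT : Measurable T) (t : ℝ) :
    cdf (γ.map T) t = γ.real {z | T z ≤ t} := by
  have : IsProbabilityMeasure (γ.map T) := Measure.isProbabilityMeasure_map hT.aemeasurable
  rw [cdf_eq_real, map_measureReal_apply hT measurableSet_Iic]
  rfl

variable {V : Type*} [NormedAddCommGroup V] [NormedSpace ℝ V] [MeasurableSpace V] [BorelSpace V]
  {γ : Measure V} [IsProbabilityMeasure γ]

/-- The distribution function of a continuous function of a random vector with full support is
strictly increasing wherever it lies strictly between zero and one, because the range of the
function is an interval. -/
lemma lt_cdf_map_of_quantile_lt [γ.IsOpenPosMeasure] {T : V → ℝ} (hT : Continuous T) {α t : ℝ}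
    (h₀ : 0 < α) (h₁ : α < 1) (ht : quantile (γ.map T) α < t) : α < cdf (γ.map T) t := by
  obtain ⟨s, hs, hst⟩ := exists_between ht
  have hαs := le_cdf_of_quantile_lt h₁ hs
  rcases lt_or_ge α (cdf (γ.map T) t) with h | h
  · exact h
  exfalso
  rw [cdf_map hT.measurable] at hαs h
  have hms : MeasurableSet {z | T z ≤ s} := (isClosed_le hT continuous_const).measurableSet
  have hmt : MeasurableSet {z | T z ≤ t} := (isClosed_le hT continuous_const).measurableSet
  -- `T` takes values on both sides of the interval `(s, t)`, hence also inside, so the interval has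
  -- positive mass; but the distribution function is constant on it
  obtain ⟨z₁, hz₁⟩ : {z | T z ≤ s}.Nonempty := by
    by_contra hne
    rw [Set.not_nonempty_iff_eq_empty.1 hne, measureReal_empty] at hαs
    linarith
  obtain ⟨z₂, hz₂⟩ : {z | T z ≤ t}ᶜ.Nonempty := by
    by_contra hne
    have h2 := probReal_compl_eq_one_sub (μ := γ) hmt
    rw [Set.not_nonempty_iff_eq_empty.1 hne, measureReal_empty] at h2
    linarith
  have hz₂' : t < T z₂ := not_le.1 hz₂
  have hz₁' : T z₁ ≤ s := hz₁
  obtain ⟨z₃, hz₃⟩ : ∃ z, T z = (s + t) / 2 :=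
    intermediate_value_univ z₁ z₂ hT ⟨by linarith, by linarith⟩
  have hopen : IsOpen {z | s < T z ∧ T z < t} :=
    (isOpen_lt continuous_const hT).inter (isOpen_lt hT continuous_const)
  have hpos := hopen.measure_pos γ ⟨z₃, by rw [Set.mem_ofPred_eq, hz₃]; constructor <;> linarith⟩
  have hpos' : 0 < γ.real {z | s < T z ∧ T z < t} :=
    ENNReal.toReal_pos hpos.ne' (measure_ne_top _ _)
  have hdisj : Disjoint {z | T z ≤ s} {z | s < T z ∧ T z < t} :=
    Set.disjoint_left.2 fun z (h1 : T z ≤ s) (h2 : s < T z ∧ T z < t) => absurd h1 (not_le.2 h2.1)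
  have hunion := measureReal_union (μ := γ) hdisj hopen.measurableSet
  have hsub : γ.real ({z | T z ≤ s} ∪ {z | s < T z ∧ T z < t}) ≤ γ.real {z | T z ≤ t} := by
    refine measureReal_mono ?_
    rintro z (h1 | h1)
    · exact le_trans (show T z ≤ s from h1) hst.le
    · exact h1.2.le
  linarith

/-- Quantiles of a continuous function of a random vector with full support are stable under
perturbations which are small relative to the norm of the vector. -/
lemma exists_forall_abs_quantile_sub_le [γ.IsOpenPosMeasure] {T : V → ℝ} (hT : Continuous T)
    {α : ℝ} (h₀ : 0 < α) (h₁ : α < 1) {ε : ℝ} (hε : 0 < ε) :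
    ∃ δ > 0, ∀ f : V → ℝ, Measurable f → (∀ z, |f z - T z| ≤ δ * ‖z‖) →
      |quantile (γ.map f) α - quantile (γ.map T) α| ≤ ε := by
  set q := quantile (γ.map T) α
  have hup : α < cdf (γ.map T) (q + ε / 2) :=
    lt_cdf_map_of_quantile_lt hT h₀ h₁ (by linarith)
  have hlo : cdf (γ.map T) (q - ε / 2) < α := cdf_lt_of_lt_quantile h₀ (by linarith)
  rw [cdf_map hT.measurable] at hup hlo
  have htail : Tendsto (fun M : ℕ => γ.real {z | (M : ℝ) ≤ ‖z‖}) atTop (𝓝 0) :=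
    (ENNReal.tendsto_toReal ENNReal.zero_ne_top).comp (tendsto_measure_norm_ge γ)
  -- the strict inequalities at `q ± ε / 2` leave room for discarding `‖z‖ ≥ M`; `δ` is then chosen
  -- so that the perturbation is at most `ε / 2` for `‖z‖ < M`
  obtain ⟨M, hM1, hM2⟩ := ((htail.eventually_lt_const (sub_pos.2 hup)).and
    (htail.eventually_lt_const (sub_pos.2 hlo))).exists
  refine ⟨ε / 2 / (M + 1), by positivity, fun f hf hfT => ?_⟩
  have hclose : ∀ z, ¬ (M : ℝ) ≤ ‖z‖ → |f z - T z| ≤ ε / 2 := by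
    intro z hz
    refine (hfT z).trans ?_
    rw [div_mul_eq_mul_div, div_le_iff₀ (by positivity)]
    gcongr
    linarith [not_le.1 hz]
  rw [abs_le]
  constructor
  · suffices cdf (γ.map f) (q - ε) < α by linarith [le_quantile h₁ this]
    rw [cdf_map hf]
    have : γ.real {z | f z ≤ q - ε}
        ≤ γ.real {z | T z ≤ q - ε / 2} + γ.real {z | (M : ℝ) ≤ ‖z‖} := by
      refine (measureReal_mono ?_).trans (measureReal_union_le _ _)
      intro z hz
      by_cases hc : (M : ℝ) ≤ ‖z‖
      · exact Or.inr hc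
      · left
        have h3 := (abs_le.1 (hclose z hc)).1
        simp only [Set.mem_ofPred_eq] at hz ⊢
        linarith
    linarith
  · suffices α ≤ cdf (γ.map f) (q + ε) by linarith [quantile_le h₀ this]
    rw [cdf_map hf]
    have : γ.real {z | T z ≤ q + ε / 2}
        ≤ γ.real {z | f z ≤ q + ε} + γ.real {z | (M : ℝ) ≤ ‖z‖} := by
      refine (measureReal_mono ?_).trans (measureReal_union_le _ _)
      intro z hz
      by_cases hc : (M : ℝ) ≤ ‖z‖
      · exact Or.inr hc
      · left
        have h3 := (abs_le.1 (hclose z hc)).2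
        simp only [Set.mem_ofPred_eq] at hz ⊢
        linarith
    linarith

end Quantile

/-! ### Directional derivative of the `L¹`-norm -/

lemma Real.measurable_sign' : Measurable Real.sign := by
  unfold Real.sign
  exact Measurable.ite measurableSet_Iio measurable_const
    (Measurable.ite measurableSet_Ioi measurable_const measurable_const)

lemma Real.abs_sign_mul_le (a b : ℝ) : |Real.sign a * b| ≤ |b| := by
  rcases Real.sign_apply_eq a with h | h | h <;> simp [h]

section SignedArea

variable {d : ℕ} {X A A' : Set (Euc d)} {θ θ' g g' : Euc d → ℝ}

lemma measurableSet_sep_of_continuousOn {P : ℝ → Prop} (hP : MeasurableSet {t | P t})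
    (hX : IsCompact X) (hθ : ContinuousOn θ X) : MeasurableSet {x ∈ X | P (θ x)} := by
  have hc : Continuous (X.domRestrict θ) := hθ.domRestrict
  have h2 := hX.measurableSet.subtype_image (hc.measurable hP)
  convert h2 using 1
  ext x
  simp [Set.domRestrict, and_comm]

/-- The volume of the set where a continuous function is nonzero but small vanishes in the limit. -/
lemma tendsto_volume_pos_abs_lt (hX : IsCompact X) (hθ : ContinuousOn θ X) :
    Tendsto (fun s : ℝ => volume.real {x ∈ X | θ x ≠ 0 ∧ |θ x| < s}) (𝓝 0) (𝓝 0) := by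
  have hfin : ∀ s : ℝ, volume {x ∈ X | θ x ≠ 0 ∧ |θ x| < s} ≠ ⊤ := fun s =>
    ((measure_mono (Set.sep_subset _ _)).trans_lt hX.measure_lt_top).ne
  have hmeas : ∀ s : ℝ, MeasurableSet {x ∈ X | θ x ≠ 0 ∧ |θ x| < s} := by
    intro s
    exact measurableSet_sep_of_continuousOn (P := fun t => t ≠ 0 ∧ |t| < s)
      (isOpen_ne.measurableSet.inter (isOpen_lt continuous_abs continuous_const).measurableSet)
      hX hθ
  have h0 : Tendsto (fun n : ℕ => volume {x ∈ X | θ x ≠ 0 ∧ |θ x| < 1 / ((n : ℝ) + 1)}) atTop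
      (𝓝 (volume (⋂ n : ℕ, {x ∈ X | θ x ≠ 0 ∧ |θ x| < 1 / ((n : ℝ) + 1)}))) := by
    refine tendsto_measure_iInter_atTop (fun n => (hmeas _).nullMeasurableSet) ?_ ⟨0, hfin _⟩
    intro n n' hn x hx
    simp only [Set.mem_ofPred_eq] at hx ⊢
    exact ⟨hx.1, hx.2.1, hx.2.2.trans_le (Nat.one_div_le_one_div hn)⟩
  have hempty : (⋂ n : ℕ, {x ∈ X | θ x ≠ 0 ∧ |θ x| < 1 / ((n : ℝ) + 1)}) = ∅ := by
    ext x
    simp only [Set.mem_iInter, Set.mem_ofPred_eq, Set.mem_empty_iff_false, iff_false]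
    intro h
    obtain ⟨n, hn⟩ := exists_nat_one_div_lt (abs_pos.2 (h 0).2.1)
    exact absurd (h n).2.2 (not_lt.2 hn.le)
  rw [hempty, measure_empty] at h0
  rw [Metric.tendsto_nhds]
  intro ε hε
  obtain ⟨n, hn⟩ := (((ENNReal.tendsto_toReal ENNReal.zero_ne_top).comp h0).eventually_lt_const
    (show (0 : ENNReal).toReal < ε by simpa using hε)).exists
  filter_upwards [eventually_lt_nhds (show (0 : ℝ) < 1 / ((n : ℝ) + 1) by positivity)] with s hs
  rw [Real.dist_eq, sub_zero, abs_of_nonneg measureReal_nonneg]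
  refine lt_of_le_of_lt ?_ hn
  refine ENNReal.toReal_mono (hfin _) (measure_mono fun x hx => ?_)
  simp only [Set.mem_ofPred_eq] at hx ⊢
  exact ⟨hx.1, hx.2.1, hx.2.2.trans hs⟩

lemma integrableOn_sign_mul (hX : IsCompact X) (hθ : ContinuousOn θ X) (hg : ContinuousOn g X) :
    IntegrableOn (fun x => Real.sign (θ x) * g x) X := by
  have hgi : IntegrableOn g X := hg.integrableOn_compact hX
  refine Integrable.mono hgi ?_ (Eventually.of_forall fun x => Real.abs_sign_mul_le _ _)
  refine AEStronglyMeasurable.mul ?_ hgi.aestronglyMeasurable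
  exact (Real.measurable_sign'.comp_aemeasurable
    (hθ.aemeasurable hX.measurableSet)).aestronglyMeasurable

open Classical in
/-- The integrand of `signedArea`. -/
def signedIntegrand (A : Set (Euc d)) (θ g : Euc d → ℝ) : Euc d → ℝ :=
  A.piecewise (fun x => |g x|) (fun x => Real.sign (θ x) * g x)

lemma signedIntegrand_of_mem {x : Euc d} (h : x ∈ A) : signedIntegrand A θ g x = |g x| := by
  classical exact Set.piecewise_eq_of_mem _ _ _ h

lemma signedIntegrand_of_notMem {x : Euc d} (h : x ∉ A) :
    signedIntegrand A θ g x = Real.sign (θ x) * g x := by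
  classical exact Set.piecewise_eq_of_notMem _ _ _ h

lemma abs_signedIntegrand_le (A : Set (Euc d)) (θ g : Euc d → ℝ) (x : Euc d) :
    |signedIntegrand A θ g x| ≤ |g x| := by
  by_cases h : x ∈ A
  · rw [signedIntegrand_of_mem h, abs_abs]
  · rw [signedIntegrand_of_notMem h]
    exact Real.abs_sign_mul_le _ _

lemma signedArea_eq_integral (hX : IsCompact X) (hA : MeasurableSet A) (hAX : A ⊆ X)
    (hθ : ContinuousOn θ X) (hg : ContinuousOn g X) :
    IntegrableOn (signedIntegrand A θ g) X ∧
      signedArea X A θ g = ∫ x in X, signedIntegrand A θ g x := by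
  classical
  have h1 : Integrable (fun x => |g x|) (volume.restrict X) := (hg.integrableOn_compact hX).abs
  have h2 : Integrable (fun x => Real.sign (θ x) * g x) (volume.restrict X) :=
    integrableOn_sign_mul hX hθ hg
  constructor
  · exact Integrable.piecewise hA h1.integrableOn h2.integrableOn
  · unfold signedIntegrand
    rw [integral_piecewise hA h1.integrableOn h2.integrableOn, Measure.restrict_restrict hA,
      Measure.restrict_restrict hA.compl, Set.inter_eq_left.2 hAX, signedArea, add_comm,
      Set.inter_comm, ← Set.sdiff_eq]

/-- Two integrands that differ by at most `a`, and by at most `a + b` on an exceptional set `D`. -/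
lemma abs_integral_sub_le {F F' : Euc d → ℝ} {D : Set (Euc d)} {a b : ℝ} (hX : IsCompact X)
    (hD : MeasurableSet D) (hDX : D ⊆ X) (hF : IntegrableOn F X) (hF' : IntegrableOn F' X)
    (h : ∀ x ∈ X, x ∉ D → |F' x - F x| ≤ a) (hb : ∀ x ∈ X, |F' x - F x| ≤ a + b) :
    |(∫ x in X, F' x) - ∫ x in X, F x| ≤ a * volume.real X + b * volume.real D := by
  classical
  rw [← integral_sub hF' hF]
  have hXfin : volume X ≠ ⊤ := hX.measure_lt_top.ne
  have hi1 : Integrable (fun _ : Euc d => a) (volume.restrict X) := integrableOn_const hXfin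
  have hi2 : Integrable (D.indicator fun _ : Euc d => b) (volume.restrict X) :=
    (show Integrable (fun _ : Euc d => b) (volume.restrict X) from
      integrableOn_const hXfin).indicator hD
  have key := norm_integral_le_of_norm_le (hi1.add hi2)
    (f := fun x => F' x - F x) (by
      filter_upwards [ae_restrict_mem hX.measurableSet] with x hx
      by_cases hxD : x ∈ D
      · simpa [hxD] using! hb x hx
      · simpa [hxD] using! h x hx hxD)
  rw [Real.norm_eq_abs] at key
  refine key.trans (le_of_eq ?_)
  simp only [Pi.add_apply]
  rw [integral_add hi1 hi2, integral_indicator_const _ hD]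
  simp [measureReal_restrict_apply hD, Set.inter_eq_left.2 hDX, mul_comm]

/-- Comparison of two signed areas whose zero sets differ by a set on which both integrands are
bounded. -/
lemma abs_signedArea_sub_le (hX : IsCompact X) (hA : MeasurableSet A) (hA' : MeasurableSet A')
    (hAA' : A ⊆ A') (hA'X : A' ⊆ X) (hθ : ContinuousOn θ X) (hθ' : ContinuousOn θ' X)
    (hg : ContinuousOn g X) (hg' : ContinuousOn g' X)
    (hsign : ∀ x ∈ X, x ∉ A' → Real.sign (θ' x) = Real.sign (θ x)) {a C : ℝ}
    (ha : ∀ x ∈ X, |g' x - g x| ≤ a) (hC : ∀ x ∈ X, |g x| ≤ C) :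
    |signedArea X A' θ' g' - signedArea X A θ g|
      ≤ a * volume.real X + 2 * C * volume.real (A' \ A) := by
  obtain ⟨hF, eF⟩ := signedArea_eq_integral hX hA (hAA'.trans hA'X) hθ hg
  obtain ⟨hF', eF'⟩ := signedArea_eq_integral hX hA' hA'X hθ' hg'
  rw [eF, eF']
  refine abs_integral_sub_le hX (MeasurableSet.diff hA' hA) (Set.sdiff_subset.trans hA'X) hF hF'
    ?_ ?_
  · intro x hx hxD
    by_cases h' : x ∈ A'
    · have h : x ∈ A := by
        by_contra h
        exact hxD ⟨h', h⟩
      rw [signedIntegrand_of_mem h', signedIntegrand_of_mem h]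
      exact (abs_abs_sub_abs_le _ _).trans (ha x hx)
    · rw [signedIntegrand_of_notMem h', signedIntegrand_of_notMem fun h => h' (hAA' h),
        hsign x hx h', ← mul_sub]
      exact (Real.abs_sign_mul_le _ _).trans (ha x hx)
  · intro x hx
    have hC0 : 0 ≤ C := (abs_nonneg _).trans (hC x hx)
    have h2 := abs_signedIntegrand_le A' θ' g' x
    have h3 := abs_signedIntegrand_le A θ g x
    have h4 : |g' x| ≤ |g' x - g x| + |g x| := by
      simpa using abs_add_le (g' x - g x) (g x)
    have := abs_sub (signedIntegrand A' θ' g' x) (signedIntegrand A θ g x)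
    linarith [ha x hx, hC x hx]

lemma Real.mul_abs_sub_abs_eq_sign_mul {u v r : ℝ} (h : |v - u| ≤ |u|) :
    r * (|v| - |u|) = Real.sign u * (r * (v - u)) := by
  rcases lt_trichotomy u 0 with hu | hu | hu
  · rw [abs_of_neg hu] at h ⊢
    have : v ≤ 0 := by linarith [(abs_le.1 h).2]
    rw [abs_of_nonpos this, Real.sign_of_neg hu]
    ring
  · subst hu
    have : v = 0 := by simpa using h
    simp [this]
  · rw [abs_of_pos hu] at h ⊢
    have : 0 ≤ v := by linarith [(abs_le.1 h).1]
    rw [abs_of_nonneg this, Real.sign_of_pos hu]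
    ring

/-- Directional differentiability of the `L¹`-norm in quantitative form: if `r (θ' - θ)` is close
to `g`, then `r (‖θ'‖₁ - ‖θ‖₁)` is close to the directional derivative of the norm at `θ` in the
direction `g`. The only points without sign control are those with `0 < |θ| < (C + a) / r`. -/
lemma abs_mul_integral_abs_sub_signedArea_le (hX : IsCompact X) (hθ : ContinuousOn θ X)
    (hθ' : ContinuousOn θ' X) (hg : ContinuousOn g X) {r a C : ℝ} (hr : 0 < r)
    (ha : ∀ x ∈ X, |r * (θ' x - θ x) - g x| ≤ a) (hC : ∀ x ∈ X, |g x| ≤ C) :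
    |r * ((∫ x in X, |θ' x|) - ∫ x in X, |θ x|) - signedArea X {x ∈ X | θ x = 0} θ g|
      ≤ a * volume.real X + 2 * C * volume.real {x ∈ X | θ x ≠ 0 ∧ |θ x| < (C + a) / r} := by
  have hA : MeasurableSet {x ∈ X | θ x = 0} :=
    measurableSet_sep_of_continuousOn (P := fun t => t = 0) (measurableSet_singleton 0) hX hθ
  have hD : MeasurableSet {x ∈ X | θ x ≠ 0 ∧ |θ x| < (C + a) / r} :=
    measurableSet_sep_of_continuousOn (P := fun t => t ≠ 0 ∧ |t| < (C + a) / r)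
      (isOpen_ne.measurableSet.inter
        (isOpen_lt continuous_abs continuous_const).measurableSet) hX hθ
  obtain ⟨hF, eF⟩ := signedArea_eq_integral hX hA (Set.sep_subset _ _) hθ hg
  have hi : IntegrableOn (fun x => |θ x|) X := (hθ.integrableOn_compact hX).abs
  have hi' : IntegrableOn (fun x => |θ' x|) X := (hθ'.integrableOn_compact hX).abs
  rw [eF, ← integral_sub hi' hi, ← integral_const_mul]
  refine abs_integral_sub_le hX hD (Set.sep_subset _ _) hF ((hi'.sub hi).const_mul r) ?_ ?_
  · intro x hx hxD
    by_cases h0 : θ x = 0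
    · have hm : x ∈ {x ∈ X | θ x = 0} := ⟨hx, h0⟩
      rw [signedIntegrand_of_mem hm]
      have h1 : r * (|θ' x| - |θ x|) = |r * (θ' x - θ x)| := by
        rw [h0, abs_mul, abs_of_pos hr]; simp
      rw [h1]
      exact (abs_abs_sub_abs_le _ _).trans (ha x hx)
    · have hm : x ∉ {x ∈ X | θ x = 0} := fun h => h0 h.2
      rw [signedIntegrand_of_notMem hm]
      have h1 : (C + a) / r ≤ |θ x| := by
        by_contra hlt
        exact hxD ⟨hx, h0, not_le.1 hlt⟩
      have h2 : |θ' x - θ x| ≤ |θ x| := by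
        refine le_trans ?_ h1
        rw [le_div_iff₀ hr]
        have h3 : |r * (θ' x - θ x)| ≤ |r * (θ' x - θ x) - g x| + |g x| := by
          simpa using abs_add_le (r * (θ' x - θ x) - g x) (g x)
        rw [abs_mul, abs_of_pos hr] at h3
        linarith [ha x hx, hC x hx]
      rw [Real.mul_abs_sub_abs_eq_sign_mul h2, ← mul_sub]
      exact (Real.abs_sign_mul_le _ _).trans (ha x hx)
  · intro x hx
    have h1 := abs_signedIntegrand_le {x ∈ X | θ x = 0} θ g x
    have h2 : |r * (|θ' x| - |θ x|)| ≤ |r * (θ' x - θ x)| := by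
      rw [abs_mul, abs_mul]
      exact mul_le_mul_of_nonneg_left (abs_abs_sub_abs_le _ _) (abs_nonneg _)
    have h3 : |r * (θ' x - θ x)| ≤ |r * (θ' x - θ x) - g x| + |g x| := by
      simpa using abs_add_le (r * (θ' x - θ x) - g x) (g x)
    have h4 := abs_sub (r * (|θ' x| - |θ x|)) (signedIntegrand {x ∈ X | θ x = 0} θ g x)
    linarith [ha x hx, hC x hx]

end SignedArea

/-! ### Differentiability of the area between the curves in the parameters -/

section OneGroup

variable {d p : ℕ} {m : Euc d → Euc p → ℝ} {X : Set (Euc d)} {B : Set (Euc p)} {β : Euc p}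

lemma inner_gradient_eq_fderiv (f : Euc p → ℝ) (b w : Euc p) :
    inner ℝ (∇ f b) w = fderiv ℝ f b w := by
  rw [gradient, InnerProductSpace.toDual_symm_apply]

lemma eventually_forall_norm_sub_le {F : Type*} [NormedAddCommGroup F] {f : Euc d × Euc p → F}
    (hX : IsCompact X) (hB : IsCompact B) (hβ : β ∈ interior B) (hf : ContinuousOn f (X ×ˢ B))
    {ε : ℝ} (hε : 0 < ε) : ∀ᶠ b in 𝓝 β, ∀ x ∈ X, ‖f (x, b) - f (x, β)‖ ≤ ε := by
  obtain ⟨δ, hδ, h⟩ := Metric.uniformContinuousOn_iff.1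
    ((hX.prod hB).uniformContinuousOn_of_continuous hf) ε hε
  filter_upwards [Metric.ball_mem_nhds β hδ, mem_interior_iff_mem_nhds.1 hβ] with b hb hbB x hx
  rw [← dist_eq_norm]
  refine (h (x, b) ⟨hx, hbB⟩ (x, β) ⟨hx, interior_subset hβ⟩ ?_).le
  rw [Prod.dist_eq]
  simpa [hδ] using hb

/-- The first order expansion in the parameter is uniform over the covariate region. -/
lemma eventually_forall_abs_sub_fderiv_le (hX : IsCompact X) (hB : IsCompact B)
    (hβ : β ∈ interior B) (hd : ∀ x ∈ X, ∀ b ∈ B, DifferentiableAt ℝ (m x) b)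
    (hc : ContinuousOn (fun q : Euc d × Euc p => fderiv ℝ (m q.1) q.2) (X ×ˢ B))
    {ε : ℝ} (hε : 0 < ε) :
    ∀ᶠ b in 𝓝 β, ∀ x ∈ X, |m x b - m x β - fderiv ℝ (m x) β (b - β)| ≤ ε * ‖b - β‖ := by
  have h1 := (eventually_forall_norm_sub_le hX hB hβ hc hε).and (mem_interior_iff_mem_nhds.1 hβ)
  obtain ⟨δ, hδ, h⟩ := Metric.eventually_nhds_iff_ball.1 h1
  filter_upwards [Metric.ball_mem_nhds β hδ] with b hb x hx
  exact (convex_ball β δ).norm_image_sub_le_of_norm_hasFDerivWithin_le'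
    (fun y hy => (hd x hx y (h y hy).2).hasFDerivAt.hasFDerivWithinAt)
    (fun y hy => (h y hy).1 x hx) (Metric.mem_ball_self hδ) hb

end OneGroup

/-- The pair of vectors as a dependent function on the two groups. -/
def pairVec {p : Fin 2 → ℕ} (u : Euc (p 0)) (v : Euc (p 1)) : (ℓ : Fin 2) → Euc (p ℓ)
  | 0 => u
  | 1 => v

lemma norm_pairVec_le {p : Fin 2 → ℕ} {u : Euc (p 0)} {v : Euc (p 1)} {c : ℝ} (hu : ‖u‖ ≤ c)
    (hv : ‖v‖ ≤ c) : ‖pairVec u v‖ ≤ c := by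
  refine (pi_norm_le_iff_of_nonneg ((norm_nonneg _).trans hu)).2 fun ℓ => ?_
  fin_cases ℓ
  exacts [hu, hv]

lemma pairVec_sub {p : Fin 2 → ℕ} (u u' : Euc (p 0)) (v v' : Euc (p 1)) :
    pairVec u v - pairVec u' v' = pairVec (u - u') (v - v') := by
  funext ℓ
  fin_cases ℓ <;> rfl

lemma continuous_pairVec {p : Fin 2 → ℕ} :
    Continuous fun z : Euc (p 0) × Euc (p 1) => (pairVec z.1 z.2 : (ℓ : Fin 2) → Euc (p ℓ)) := by
  refine continuous_pi fun ℓ => ?_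
  fin_cases ℓ
  exacts [continuous_fst, continuous_snd]

namespace TwoSample

variable {Ω : Type*} {d : ℕ} {p k : Fin 2 → ℕ} (R : TwoSample Ω d p k)

/-- The difference of the regression curves with parameters `b`. -/
def curveDiff (b : (ℓ : Fin 2) → Euc (p ℓ)) (x : Euc d) : ℝ := R.m 0 x (b 0) - R.m 1 x (b 1)

/-- The derivative of `curveDiff` with respect to the parameters at `b`, in the direction `w`. -/
def tangent (b w : (ℓ : Fin 2) → Euc (p ℓ)) (x : Euc d) : ℝ :=
  fderiv ℝ (R.m 0 x) (b 0) (w 0) - fderiv ℝ (R.m 1 x) (b 1) (w 1)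

/-- The directional derivative, at the true parameters, of the area between the curves. -/
def dirDeriv (w : (ℓ : Fin 2) → Euc (p ℓ)) : ℝ :=
  signedArea R.X R.zeroSet R.θ (R.tangent R.β w)

lemma tangent_sub (b w w' : (ℓ : Fin 2) → Euc (p ℓ)) (x : Euc d) :
    R.tangent b (w - w') x = R.tangent b w x - R.tangent b w' x := by
  simp only [tangent, Pi.sub_apply, map_sub]
  ring

lemma tangent_smul (b w : (ℓ : Fin 2) → Euc (p ℓ)) (r : ℝ) (x : Euc d) :
    R.tangent b (r • w) x = r * R.tangent b w x := by
  simp only [tangent, Pi.smul_apply, map_smul, smul_eq_mul]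
  ring

variable {R} [MeasurableSpace Ω] {μ : Measure Ω}

namespace Assumptions

lemma beta_mem (hR : R.Assumptions μ) (ℓ : Fin 2) : R.β ℓ ∈ R.B ℓ :=
  interior_subset (hR.true_param_mem ℓ)

lemma continuousOn_curveDiff (hR : R.Assumptions μ) {b : (ℓ : Fin 2) → Euc (p ℓ)}
    (hb : ∀ ℓ, b ℓ ∈ R.B ℓ) : ContinuousOn (R.curveDiff b) R.X := by
  have h : ∀ ℓ, ContinuousOn (fun x => R.m ℓ x (b ℓ)) R.X := fun ℓ =>
    (hR.continuous ℓ).comp (f := fun x => (x, b ℓ)) (by fun_prop) fun x hx => ⟨hx, hb ℓ⟩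
  exact (h 0).sub (h 1)

lemma continuousOn_fderiv (hR : R.Assumptions μ) {ℓ : Fin 2} {b : Euc (p ℓ)} (hb : b ∈ R.B ℓ) :
    ContinuousOn (fun x => fderiv ℝ (R.m ℓ x) b) R.X :=
  (hR.continuous_deriv ℓ).comp (f := fun x => (x, b)) (by fun_prop) fun x hx => ⟨hx, hb⟩

lemma continuousOn_tangent (hR : R.Assumptions μ) {b : (ℓ : Fin 2) → Euc (p ℓ)}
    (hb : ∀ ℓ, b ℓ ∈ R.B ℓ) (w : (ℓ : Fin 2) → Euc (p ℓ)) :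
    ContinuousOn (R.tangent b w) R.X :=
  ((hR.continuousOn_fderiv (hb 0)).clm_apply continuousOn_const).sub
    ((hR.continuousOn_fderiv (hb 1)).clm_apply continuousOn_const)

lemma exists_abs_tangent_le (hR : R.Assumptions μ) {b : (ℓ : Fin 2) → Euc (p ℓ)}
    (hb : ∀ ℓ, b ℓ ∈ R.B ℓ) :
    ∃ C > 0, ∀ x ∈ R.X, ∀ w, |R.tangent b w x| ≤ C * ‖w‖ := by
  have h : ∀ ℓ, ∃ C, ∀ x ∈ R.X, ‖fderiv ℝ (R.m ℓ x) (b ℓ)‖ ≤ C := fun ℓ =>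
    hR.compact_region.exists_bound_of_continuousOn (hR.continuousOn_fderiv (hb ℓ))
  obtain ⟨C₀, h₀⟩ := h 0
  obtain ⟨C₁, h₁⟩ := h 1
  refine ⟨|C₀| + |C₁| + 1, by positivity, fun x hx w => ?_⟩
  have e₀ := (fderiv ℝ (R.m 0 x) (b 0)).le_of_opNorm_le ((h₀ x hx).trans (le_abs_self _)) (w 0)
  have e₁ := (fderiv ℝ (R.m 1 x) (b 1)).le_of_opNorm_le ((h₁ x hx).trans (le_abs_self _)) (w 1)
  have n₀ := mul_le_mul_of_nonneg_left (norm_le_pi_norm w 0) (abs_nonneg C₀)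
  have n₁ := mul_le_mul_of_nonneg_left (norm_le_pi_norm w 1) (abs_nonneg C₁)
  rw [Real.norm_eq_abs] at e₀ e₁
  have := abs_sub (fderiv ℝ (R.m 0 x) (b 0) (w 0)) (fderiv ℝ (R.m 1 x) (b 1) (w 1))
  unfold tangent
  linarith [norm_nonneg w]

lemma eventually_abs_tangent_sub_le (hR : R.Assumptions μ) {ε : ℝ} (hε : 0 < ε) :
    ∀ᶠ b in 𝓝 R.β, ∀ x ∈ R.X, ∀ w, |R.tangent b w x - R.tangent R.β w x| ≤ ε * ‖w‖ := by
  have h : ∀ ℓ, ∀ᶠ b : (ℓ : Fin 2) → Euc (p ℓ) in 𝓝 R.β, ∀ x ∈ R.X,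
      ‖fderiv ℝ (R.m ℓ x) (b ℓ) - fderiv ℝ (R.m ℓ x) (R.β ℓ)‖ ≤ ε / 2 := fun ℓ =>
    ((continuous_apply ℓ).tendsto R.β).eventually (eventually_forall_norm_sub_le
      hR.compact_region (hR.compact_param ℓ) (hR.true_param_mem ℓ) (hR.continuous_deriv ℓ)
      (half_pos hε))
  filter_upwards [h 0, h 1] with b h₀ h₁ x hx w
  have e₀ := ContinuousLinearMap.le_of_opNorm_le _ (h₀ x hx) (w 0)
  have e₁ := ContinuousLinearMap.le_of_opNorm_le _ (h₁ x hx) (w 1)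
  have n₀ := mul_le_mul_of_nonneg_left (norm_le_pi_norm w 0) (half_pos hε).le
  have n₁ := mul_le_mul_of_nonneg_left (norm_le_pi_norm w 1) (half_pos hε).le
  rw [Real.norm_eq_abs] at e₀ e₁
  have := abs_sub ((fderiv ℝ (R.m 0 x) (b 0) - fderiv ℝ (R.m 0 x) (R.β 0)) (w 0))
    ((fderiv ℝ (R.m 1 x) (b 1) - fderiv ℝ (R.m 1 x) (R.β 1)) (w 1))
  have e : R.tangent b w x - R.tangent R.β w x =
      (fderiv ℝ (R.m 0 x) (b 0) - fderiv ℝ (R.m 0 x) (R.β 0)) (w 0)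
        - (fderiv ℝ (R.m 1 x) (b 1) - fderiv ℝ (R.m 1 x) (R.β 1)) (w 1) := by
    simp only [tangent, sub_apply]
    ring
  rw [e]
  linarith

lemma eventually_abs_curveDiff_sub_le (hR : R.Assumptions μ) {ε : ℝ} (hε : 0 < ε) :
    ∀ᶠ b in 𝓝 R.β, ∀ x ∈ R.X,
      |R.curveDiff b x - R.θ x - R.tangent R.β (b - R.β) x| ≤ ε * ‖b - R.β‖ := by
  have h : ∀ ℓ, ∀ᶠ b : (ℓ : Fin 2) → Euc (p ℓ) in 𝓝 R.β, ∀ x ∈ R.X,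
      |R.m ℓ x (b ℓ) - R.m ℓ x (R.β ℓ) - fderiv ℝ (R.m ℓ x) (R.β ℓ) (b ℓ - R.β ℓ)|
        ≤ ε / 2 * ‖b ℓ - R.β ℓ‖ := fun ℓ =>
    ((continuous_apply ℓ).tendsto R.β).eventually (eventually_forall_abs_sub_fderiv_le
      hR.compact_region (hR.compact_param ℓ) (hR.true_param_mem ℓ)
      (fun x hx b hb => (hR.differentiable ℓ x hx b hb).1) (hR.continuous_deriv ℓ) (half_pos hε))
  filter_upwards [h 0, h 1] with b h₀ h₁ x hx
  have e₀ := h₀ x hx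
  have e₁ := h₁ x hx
  have n₀ := mul_le_mul_of_nonneg_left (norm_le_pi_norm (b - R.β) 0) (half_pos hε).le
  have n₁ := mul_le_mul_of_nonneg_left (norm_le_pi_norm (b - R.β) 1) (half_pos hε).le
  simp only [Pi.sub_apply] at n₀ n₁
  have := abs_sub (R.m 0 x (b 0) - R.m 0 x (R.β 0) - fderiv ℝ (R.m 0 x) (R.β 0) (b 0 - R.β 0))
    (R.m 1 x (b 1) - R.m 1 x (R.β 1) - fderiv ℝ (R.m 1 x) (R.β 1) (b 1 - R.β 1))
  have e : R.curveDiff b x - R.θ x - R.tangent R.β (b - R.β) x =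
      (R.m 0 x (b 0) - R.m 0 x (R.β 0) - fderiv ℝ (R.m 0 x) (R.β 0) (b 0 - R.β 0))
        - (R.m 1 x (b 1) - R.m 1 x (R.β 1) - fderiv ℝ (R.m 1 x) (R.β 1) (b 1 - R.β 1)) := by
    simp only [tangent, curveDiff, θ, Pi.sub_apply]
    ring
  rw [e]
  linarith

lemma continuousOn_theta (hR : R.Assumptions μ) : ContinuousOn R.θ R.X :=
  hR.continuousOn_curveDiff hR.beta_mem

lemma measurableSet_zeroSet (hR : R.Assumptions μ) : MeasurableSet R.zeroSet :=
  measurableSet_sep_of_continuousOn (P := fun t => t = 0) (measurableSet_singleton 0)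
    hR.compact_region hR.continuousOn_theta

lemma continuous_signedArea_tangent (hR : R.Assumptions μ) {b : (ℓ : Fin 2) → Euc (p ℓ)}
    (hb : ∀ ℓ, b ℓ ∈ R.B ℓ) {A : Set (Euc d)} (hA : MeasurableSet A) (hAX : A ⊆ R.X)
    {θ : Euc d → ℝ} (hθ : ContinuousOn θ R.X) :
    Continuous fun w => signedArea R.X A θ (R.tangent b w) := by
  obtain ⟨C, hC0, hC⟩ := hR.exists_abs_tangent_le hb
  have key : ∀ w w' : (ℓ : Fin 2) → Euc (p ℓ),
      |signedArea R.X A θ (R.tangent b w) - signedArea R.X A θ (R.tangent b w')|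
        ≤ C * volume.real R.X * ‖w - w'‖ := by
    intro w w'
    have h := abs_signedArea_sub_le hR.compact_region hA hA subset_rfl hAX hθ hθ
      (hR.continuousOn_tangent hb w') (hR.continuousOn_tangent hb w) (fun _ _ _ => rfl)
      (a := C * ‖w - w'‖) (C := C * ‖w'‖)
      (fun x hx => by rw [← tangent_sub]; exact hC x hx _) (fun x hx => hC x hx _)
    simp only [sdiff_self, Set.bot_eq_empty, measureReal_empty, mul_zero, add_zero] at h
    linarith
  refine (LipschitzWith.of_dist_le_mul (K := (C * volume.real R.X).toNNReal)
    fun w w' => ?_).continuous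
  rw [Real.coe_toNNReal _ (by positivity), Real.dist_eq, dist_eq_norm]
  exact key w w'

lemma continuous_dirDeriv (hR : R.Assumptions μ) : Continuous R.dirDeriv :=
  hR.continuous_signedArea_tangent hR.beta_mem hR.measurableSet_zeroSet (Set.sep_subset _ _)
    hR.continuousOn_theta

section Filter

variable {ι : Type*} {l : Filter ι} {r : ι → ℝ} {b : ι → (ℓ : Fin 2) → Euc (p ℓ)} {M : ℝ}

lemma _root_.tendsto_of_norm_smul_sub_le {V : Type*} [NormedAddCommGroup V] [NormedSpace ℝ V]
    {b : ι → V} {β : V} (hr : Tendsto r l atTop)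
    (hM : ∀ᶠ i in l, ‖r i • (b i - β)‖ ≤ M) : Tendsto b l (𝓝 β) := by
  rw [tendsto_iff_norm_sub_tendsto_zero]
  have h0 : Tendsto (fun i => M / r i) l (𝓝 0) := hr.const_div_atTop M
  refine tendsto_of_tendsto_of_tendsto_of_le_of_le' tendsto_const_nhds h0
    (Eventually.of_forall fun i => norm_nonneg _) ?_
  filter_upwards [hM, hr.eventually_gt_atTop 0] with i hi hri
  rw [le_div_iff₀ hri, mul_comm]
  rwa [norm_smul, Real.norm_eq_abs, abs_of_pos hri] at hi

/-- The rescaled deviation of the curves is uniformly close to its linearization. -/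
lemma eventually_abs_smul_curveDiff_sub_le (hR : R.Assumptions μ) (hr : Tendsto r l atTop)
    (hM : ∀ᶠ i in l, ‖r i • (b i - R.β)‖ ≤ M) {ε : ℝ} (hε : 0 < ε) :
    ∀ᶠ i in l, ∀ x ∈ R.X,
      |r i * (R.curveDiff (b i) x - R.θ x) - R.tangent R.β (r i • (b i - R.β)) x| ≤ ε * M := by
  have h1 := (tendsto_of_norm_smul_sub_le hr hM).eventually (hR.eventually_abs_curveDiff_sub_le hε)
  filter_upwards [h1, hM, hr.eventually_gt_atTop 0] with i h2 h3 hri x hx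
  rw [tangent_smul, ← mul_sub, abs_mul, abs_of_pos hri]
  rw [norm_smul, Real.norm_eq_abs, abs_of_pos hri] at h3
  calc _ ≤ r i * (ε * ‖b i - R.β‖) := mul_le_mul_of_nonneg_left (h2 x hx) hri.le
    _ = ε * (r i * ‖b i - R.β‖) := by ring
    _ ≤ ε * M := mul_le_mul_of_nonneg_left h3 hε.le

/-- Directional differentiability of the area between the curves at the true parameters: where the
rescaled deviation of the parameters stays bounded, the rescaled deviation of the area is
asymptotically the directional derivative. -/
lemma tendsto_smul_areaBetween_sub (hR : R.Assumptions μ) (hr : Tendsto r l atTop)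
    (hb : ∀ i ℓ, b i ℓ ∈ R.B ℓ) (hM : ∀ᶠ i in l, ‖r i • (b i - R.β)‖ ≤ M) :
    Tendsto (fun i => r i * (areaBetween R.X (R.m 0) (R.m 1) (b i 0) (b i 1) - R.dist)
      - R.dirDeriv (r i • (b i - R.β))) l (𝓝 0) := by
  obtain ⟨C, hC0, hC⟩ := hR.exists_abs_tangent_le hR.beta_mem
  rcases l.eq_or_neBot with rfl | hl
  · exact tendsto_bot
  have hM0 : 0 ≤ M := by
    obtain ⟨i, hi⟩ := hM.exists
    exact (norm_nonneg _).trans hi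
  rw [Metric.tendsto_nhds]
  intro η hη
  -- `ε` makes the first of the two error terms small; the second vanishes because its set shrinks
  obtain ⟨ε, hε, hεη⟩ : ∃ ε > 0, ε * M * volume.real R.X < η / 2 := by
    refine ⟨η / 2 / (M * volume.real R.X + 1), by positivity, ?_⟩
    rw [mul_assoc, div_mul_eq_mul_div, div_lt_iff₀ (by positivity)]
    nlinarith
  have hs : Tendsto (fun i => 2 * (C * M) *
      volume.real {x ∈ R.X | R.θ x ≠ 0 ∧ |R.θ x| < (C * M + ε * M) / r i}) l (𝓝 0) := by
    have h := ((tendsto_volume_pos_abs_lt hR.compact_region hR.continuousOn_theta).comp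
      (hr.const_div_atTop (C * M + ε * M))).const_mul (2 * (C * M))
    rwa [mul_zero] at h
  filter_upwards [hR.eventually_abs_smul_curveDiff_sub_le hr hM hε, hM, hr.eventually_gt_atTop 0,
    hs.eventually_lt_const (half_pos hη)] with i h1 h2 hri h3
  rw [Real.dist_eq, sub_zero]
  have h4 := abs_mul_integral_abs_sub_signedArea_le hR.compact_region hR.continuousOn_theta
    (hR.continuousOn_curveDiff (hb i)) (hR.continuousOn_tangent hR.beta_mem _) hri h1
    (C := C * M) fun x hx => (hC x hx _).trans (mul_le_mul_of_nonneg_left h2 hC0.le)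
  refine lt_of_le_of_lt h4 ?_
  linarith

lemma _root_.Real.sign_eq_sign_of_abs_sub_lt {u v : ℝ} (h : |v - u| < |v|) :
    Real.sign v = Real.sign u := by
  rcases lt_trichotomy v 0 with hv | hv | hv
  · rw [abs_of_neg hv] at h
    have : u < 0 := by linarith [(abs_lt.1 h).1]
    rw [Real.sign_of_neg hv, Real.sign_of_neg this]
  · subst hv
    simp only [abs_zero] at h
    exact absurd h (not_lt.2 (abs_nonneg _))
  · rw [abs_of_pos hv] at h
    have : 0 < u := by linarith [(abs_lt.1 h).2]
    rw [Real.sign_of_pos hv, Real.sign_of_pos this]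

/-- The plug-in functional is uniformly close to the directional derivative, relative to the norm
of the Gaussian vector, when the threshold `s` tends to zero more slowly than the parameter
error. -/
lemma eventually_abs_signedArea_sub_dirDeriv_le (hR : R.Assumptions μ) (hr : Tendsto r l atTop)
    (hb : ∀ i ℓ, b i ℓ ∈ R.B ℓ) (hM : ∀ᶠ i in l, ‖r i • (b i - R.β)‖ ≤ M)
    {s : ι → ℝ} (hs : Tendsto s l (𝓝 0)) (hrs : Tendsto (fun i => r i * s i) l atTop)
    {L₀ : ι → Euc (p 0) →L[ℝ] Euc (p 0)} {L₁ : ι → Euc (p 1) →L[ℝ] Euc (p 1)}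
    {K₀ : Euc (p 0) →L[ℝ] Euc (p 0)} {K₁ : Euc (p 1) →L[ℝ] Euc (p 1)}
    (hL₀ : Tendsto L₀ l (𝓝 K₀)) (hL₁ : Tendsto L₁ l (𝓝 K₁)) {δ : ℝ} (hδ : 0 < δ) :
    ∀ᶠ i in l, ∀ z : Euc (p 0) × Euc (p 1),
      |signedArea R.X {x ∈ R.X | |R.curveDiff (b i) x| < s i} (R.curveDiff (b i))
          (R.tangent (b i) (pairVec (L₀ i z.1) (L₁ i z.2)))
        - R.dirDeriv (pairVec (K₀ z.1) (K₁ z.2))| ≤ δ * ‖z‖ := by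
  obtain ⟨C, hC0, hC⟩ := hR.exists_abs_tangent_le hR.beta_mem
  -- `Λ` bounds the operator norms of `L₀ i` and `L₁ i` eventually, and those of `K₀` and `K₁`
  set Λ : ℝ := ‖K₀‖ + ‖K₁‖ + 1
  have hΛ0 : 0 < Λ := by positivity
  obtain ⟨ε, hε, hε1, hεδ⟩ : ∃ ε > 0, ε ≤ 1 ∧ ε * (Λ + C) * volume.real R.X ≤ δ / 2 := by
    refine ⟨min 1 (δ / 2 / ((Λ + C) * volume.real R.X + 1)), by positivity, min_le_left _ _, ?_⟩
    rw [mul_assoc]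
    refine (mul_le_mul_of_nonneg_right (min_le_right _ _) (by positivity)).trans ?_
    rw [div_mul_eq_mul_div, div_le_iff₀ (by positivity)]
    nlinarith
  have hvol : Tendsto (fun i => 2 * (C * Λ) *
      volume.real {x ∈ R.X | R.θ x ≠ 0 ∧ |R.θ x| < 2 * s i}) l (𝓝 0) := by
    have h2s : Tendsto (fun i => 2 * s i) l (𝓝 0) := by simpa using hs.const_mul 2
    have h := ((tendsto_volume_pos_abs_lt hR.compact_region hR.continuousOn_theta).comp
      h2s).const_mul (2 * (C * Λ))
    rwa [mul_zero] at h
  have hclose : ∀ {n : ℕ} {L : ι → Euc n →L[ℝ] Euc n} {K : Euc n →L[ℝ] Euc n},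
      Tendsto L l (𝓝 K) → ∀ᶠ i in l, ‖L i - K‖ ≤ ε := by
    intro n L K h
    filter_upwards [h.eventually (Metric.closedBall_mem_nhds K hε)] with i hi
    rwa [← dist_eq_norm]
  filter_upwards [hR.eventually_abs_smul_curveDiff_sub_le hr hM one_pos, hM,
    hr.eventually_gt_atTop 0, hrs.eventually_gt_atTop (M + C * M), hclose hL₀, hclose hL₁,
    (tendsto_of_norm_smul_sub_le hr hM).eventually (hR.eventually_abs_tangent_sub_le hε),
    hvol.eventually_lt_const (half_pos hδ)] with i h1 h2 hri h3 hL₀i hL₁i h4 h5 z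
  -- the estimation error of the curves is of order `1 / r`, hence below the threshold
  have hdiff : ∀ x ∈ R.X, |R.curveDiff (b i) x - R.θ x| < s i := by
    intro x hx
    have e1 := h1 x hx
    have e2 := (hC x hx (r i • (b i - R.β))).trans (mul_le_mul_of_nonneg_left h2 hC0.le)
    have e3 : |r i * (R.curveDiff (b i) x - R.θ x)| ≤ M + C * M := by
      have := abs_add_le (r i * (R.curveDiff (b i) x - R.θ x)
        - R.tangent R.β (r i • (b i - R.β)) x) (R.tangent R.β (r i • (b i - R.β)) x)
      rw [sub_add_cancel] at this
      linarith
    rw [abs_mul, abs_of_pos hri] at e3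
    exact lt_of_mul_lt_mul_left (e3.trans_lt h3) hri.le
  have hA' : MeasurableSet {x ∈ R.X | |R.curveDiff (b i) x| < s i} :=
    measurableSet_sep_of_continuousOn (P := fun t => |t| < s i)
      (isOpen_lt continuous_abs continuous_const).measurableSet hR.compact_region
      (hR.continuousOn_curveDiff (hb i))
  have hz0 := norm_nonneg z
  have hw : ‖(pairVec (L₀ i z.1) (L₁ i z.2) : (ℓ : Fin 2) → Euc (p ℓ))‖ ≤ Λ * ‖z‖ := by
    refine norm_pairVec_le ?_ ?_
    · refine ((L₀ i).le_of_opNorm_le (c := Λ) ?_ z.1).trans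
        (mul_le_mul_of_nonneg_left (norm_fst_le z) hΛ0.le)
      have := norm_add_le (L₀ i - K₀) K₀
      rw [sub_add_cancel] at this
      linarith [norm_nonneg K₁]
    · refine ((L₁ i).le_of_opNorm_le (c := Λ) ?_ z.2).trans
        (mul_le_mul_of_nonneg_left (norm_snd_le z) hΛ0.le)
      have := norm_add_le (L₁ i - K₁) K₁
      rw [sub_add_cancel] at this
      linarith [norm_nonneg K₀]
  have hw0 : ‖(pairVec (K₀ z.1) (K₁ z.2) : (ℓ : Fin 2) → Euc (p ℓ))‖ ≤ Λ * ‖z‖ := by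
    refine norm_pairVec_le ?_ ?_
    · exact (K₀.le_of_opNorm_le (c := Λ) (by linarith [norm_nonneg K₁]) z.1).trans
        (mul_le_mul_of_nonneg_left (norm_fst_le z) hΛ0.le)
    · exact (K₁.le_of_opNorm_le (c := Λ) (by linarith [norm_nonneg K₀]) z.2).trans
        (mul_le_mul_of_nonneg_left (norm_snd_le z) hΛ0.le)
  have hww : ‖(pairVec (L₀ i z.1) (L₁ i z.2) : (ℓ : Fin 2) → Euc (p ℓ))
      - pairVec (K₀ z.1) (K₁ z.2)‖ ≤ ε * ‖z‖ := by
    rw [pairVec_sub]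
    refine norm_pairVec_le ?_ ?_
    · exact ((L₀ i - K₀).le_of_opNorm_le hL₀i z.1).trans
        (mul_le_mul_of_nonneg_left (norm_fst_le z) hε.le)
    · exact ((L₁ i - K₁).le_of_opNorm_le hL₁i z.2).trans
        (mul_le_mul_of_nonneg_left (norm_snd_le z) hε.le)
  have key := abs_signedArea_sub_le hR.compact_region hR.measurableSet_zeroSet hA'
    (fun x hx => ⟨hx.1, by simpa [hx.2] using hdiff x hx.1⟩) (Set.sep_subset _ _)
    hR.continuousOn_theta (hR.continuousOn_curveDiff (hb i))
    (hR.continuousOn_tangent hR.beta_mem (pairVec (K₀ z.1) (K₁ z.2)))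
    (hR.continuousOn_tangent (hb i) (pairVec (L₀ i z.1) (L₁ i z.2)))
    (fun x hx hxA => Real.sign_eq_sign_of_abs_sub_lt
      ((hdiff x hx).trans_le (not_lt.1 fun h => hxA ⟨hx, h⟩)))
    (a := ε * (Λ + C) * ‖z‖) (C := C * Λ * ‖z‖)
    (fun x hx => by
      have e1 := h4 x hx (pairVec (L₀ i z.1) (L₁ i z.2))
      have e2 := hC x hx (pairVec (L₀ i z.1) (L₁ i z.2) - pairVec (K₀ z.1) (K₁ z.2))
      rw [tangent_sub] at e2
      have e3 := mul_le_mul_of_nonneg_left hw hε.le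
      have e4 := mul_le_mul_of_nonneg_left hww hC0.le
      have := abs_sub_le (R.tangent (b i) (pairVec (L₀ i z.1) (L₁ i z.2)) x)
        (R.tangent R.β (pairVec (L₀ i z.1) (L₁ i z.2)) x)
        (R.tangent R.β (pairVec (K₀ z.1) (K₁ z.2)) x)
      linarith)
    (fun x hx => by
      have e2 := hC x hx (pairVec (K₀ z.1) (K₁ z.2))
      have e4 := mul_le_mul_of_nonneg_left hw0 hC0.le
      linarith)
  refine key.trans ?_
  -- the estimated and the true zero set differ only where `θ` is small but nonzero
  have hsub : volume.real ({x ∈ R.X | |R.curveDiff (b i) x| < s i} \ R.zeroSet)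
      ≤ volume.real {x ∈ R.X | R.θ x ≠ 0 ∧ |R.θ x| < 2 * s i} := by
    refine measureReal_mono (fun x hx => ⟨hx.1.1, fun h => hx.2 ⟨hx.1.1, h⟩, ?_⟩)
      ((measure_mono (Set.sep_subset _ _)).trans_lt hR.compact_region.measure_lt_top).ne
    have e1 : |R.curveDiff (b i) x| < s i := hx.1.2
    have e2 := hdiff x hx.1.1
    have := abs_sub_abs_le_abs_sub (R.θ x) (R.curveDiff (b i) x)
    rw [abs_sub_comm] at this
    linarith
  have e5 := mul_le_mul_of_nonneg_left hsub (show 0 ≤ 2 * (C * Λ) by positivity)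
  have e6 := mul_le_mul_of_nonneg_right (e5.trans h5.le) hz0
  have e7 := mul_le_mul_of_nonneg_right hεδ hz0
  linarith

end Filter

end Assumptions

end TwoSample

/-! ### The central limit theorem for several samples -/

section CentralLimit

/-- The exponential limit with exponents that are an arbitrary sequence of natural numbers. -/
lemma Complex.tendsto_one_add_pow_exp_of_tendsto_mul {ι : Type*} {l : Filter ι} {N : ι → ℕ}
    {g : ι → ℂ} {t : ℂ} (hg : Tendsto g l (𝓝 0)) (h : Tendsto (fun i => N i * g i) l (𝓝 t)) :
    Tendsto (fun i => (1 + g i) ^ N i) l (𝓝 (Complex.exp t)) := by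
  have hlt : ∀ᶠ i in l, ‖g i‖ < 1 / 2 := by
    have := hg.norm
    rw [norm_zero] at this
    exact this.eventually_lt_const (by norm_num)
  have h1 : Tendsto (fun i => (N i : ℂ) * (Complex.log (1 + g i) - g i)) l (𝓝 0) := by
    have h2 : Tendsto (fun i => ‖(N i : ℂ) * g i‖ * ‖g i‖) l (𝓝 0) := by
      have := h.norm.mul hg.norm
      rwa [norm_zero, mul_zero] at this
    refine squeeze_zero_norm' ?_ h2
    filter_upwards [hlt] with i hi
    have e1 := Complex.norm_log_one_add_sub_self_le (z := g i) (by linarith)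
    have e2 : (1 - ‖g i‖)⁻¹ ≤ 2 := by
      rw [inv_le_comm₀ (by linarith) (by norm_num)]
      linarith
    rw [norm_mul, norm_mul, mul_assoc]
    refine mul_le_mul_of_nonneg_left (e1.trans ?_) (norm_nonneg _)
    have e3 := mul_le_mul_of_nonneg_left e2 (sq_nonneg ‖g i‖)
    linarith [sq ‖g i‖]
  have h3 : Tendsto (fun i => (N i : ℂ) * Complex.log (1 + g i)) l (𝓝 t) := by
    have := h1.add h
    rw [zero_add] at this
    refine this.congr fun i => ?_
    ring
  refine ((Complex.continuous_exp.tendsto t).comp h3).congr' ?_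
  filter_upwards [hlt] with i hi
  have hne : 1 + g i ≠ 0 := by
    intro h0
    have h5 : g i = -1 := by linear_combination h0
    rw [h5, norm_neg, norm_one] at hi
    norm_num at hi
  rw [Function.comp_apply, Complex.exp_nat_mul, Complex.exp_log hne]

variable {Ω : Type*} [MeasurableSpace Ω] {μ : Measure Ω} [IsProbabilityMeasure μ]

/-- The second order expansion at zero of the characteristic function of a centred square integrable
random variable. -/
lemma isLittleO_charFun_sub {X : Ω → ℝ} (hX : MemLp X 2 μ) (h0 : ∫ ω, X ω ∂μ = 0) :
    (fun s : ℝ => charFun (μ.map X) s - (1 - ((∫ ω, X ω ^ 2 ∂μ : ℝ) : ℂ) * s ^ 2 / 2))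
      =o[𝓝 0] fun s : ℝ => s ^ 2 := by
  have hXm : AEMeasurable X μ := hX.aemeasurable
  have : IsProbabilityMeasure (μ.map X) := Measure.isProbabilityMeasure_map hXm
  have hid : MemLp id 2 (μ.map X) := by
    rw [memLp_map_measure_iff (by fun_prop) hXm]
    exact hX
  have h := taylor_isLittleO_univ (f := charFun (μ.map X)) (n := 2) (x₀ := 0) (contDiff_charFun hid)
  simp only [taylorWithinEval_charFun_two_zero hXm hid, sub_zero] at h
  simpa [h0] using! h

variable {E : Type*} [NormedAddCommGroup E] [InnerProductSpace ℝ E] [MeasurableSpace E]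
  [BorelSpace E] [SecondCountableTopology E]

lemma tendsto_charFun_smul_pow {ι : Type*} {l : Filter ι} {X : Ω → E} (hXm : Measurable X)
    (hX : MemLp X 2 μ) (t : E) (h0 : ∫ ω, inner ℝ (X ω) t ∂μ = 0) {N : ι → ℕ} {a : ι → ℝ} {v : ℝ}
    (ha : Tendsto a l (𝓝 0)) (hv : Tendsto (fun i => N i * a i ^ 2) l (𝓝 v)) :
    Tendsto (fun i => charFun (μ.map X) (a i • t) ^ N i) l
      (𝓝 (Complex.exp (-((v * ∫ ω, inner ℝ (X ω) t ^ 2 ∂μ : ℝ) : ℂ) / 2))) := by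
  have hY : MemLp (fun ω => inner ℝ (X ω) t) 2 μ := hX.inner_const t
  set V : ℝ := ∫ ω, inner ℝ (X ω) t ^ 2 ∂μ with hV
  have hchar : ∀ s : ℝ,
      charFun (μ.map X) (s • t) = charFun (μ.map fun ω => inner ℝ (X ω) t) s := by
    intro s
    rw [charFun_apply, charFun_apply_real,
      integral_map hXm.aemeasurable (by fun_prop), integral_map (by fun_prop) (by fun_prop)]
    simp [inner_smul_right]
  have hlo := (isLittleO_charFun_sub hY h0).comp_tendsto ha
  set f : ι → ℂ := fun i => charFun (μ.map fun ω => inner ℝ (X ω) t) (a i)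
    - (1 - (V : ℂ) * a i ^ 2 / 2) with hf
  have hf0 : f =o[l] fun i => a i ^ 2 := hlo
  have ha2 : Tendsto (fun i => a i ^ 2) l (𝓝 0) := by simpa using ha.pow 2
  have hac : Tendsto (fun i => ((a i ^ 2 : ℝ) : ℂ)) l (𝓝 0) := by
    have h := (Complex.continuous_ofReal.tendsto 0).comp ha2
    rwa [Complex.ofReal_zero] at h
  have hvc : Tendsto (fun i => ((N i * a i ^ 2 : ℝ) : ℂ)) l (𝓝 v) :=
    (Complex.continuous_ofReal.tendsto v).comp hv
  have hg : Tendsto (fun i => f i - (V : ℂ) / 2 * ((a i ^ 2 : ℝ) : ℂ)) l (𝓝 0) := by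
    have h1 : Tendsto f l (𝓝 0) := hf0.trans_tendsto ha2
    simpa using h1.sub (hac.const_mul ((V : ℂ) / 2))
  have hNf : Tendsto (fun i => (N i : ℂ) * f i) l (𝓝 0) := by
    have h1 : (fun i => (N i : ℂ) * f i) =o[l] fun i => (N i : ℝ) * a i ^ 2 := by
      refine Asymptotics.IsBigO.mul_isLittleO ?_ hf0
      exact Asymptotics.isBigO_of_le _ fun i => by simp
    exact (Asymptotics.isLittleO_one_iff ℝ).1 (h1.trans_isBigO (hv.isBigO_one ℝ))
  have hNg : Tendsto (fun i => (N i : ℂ) * (f i - (V : ℂ) / 2 * ((a i ^ 2 : ℝ) : ℂ))) l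
      (𝓝 (-((v * V : ℝ) : ℂ) / 2)) := by
    have h2 := hNf.sub (hvc.const_mul ((V : ℂ) / 2))
    have e : (0 : ℂ) - (V : ℂ) / 2 * v = -((v * V : ℝ) : ℂ) / 2 := by push_cast; ring
    rw [e] at h2
    refine h2.congr fun i => ?_
    push_cast
    ring
  refine (Complex.tendsto_one_add_pow_exp_of_tendsto_mul hg hNg).congr fun i => ?_
  rw [hchar, hf]
  congr 1
  push_cast
  ring

/-- The central limit theorem for weighted sums of finitely many independent samples whose sizes
vary along the sequence, in terms of characteristic functions. -/
lemma tendsto_charFun_sum_samples {ι : Type*} [Fintype ι] {ψ : ι → ℕ → Ω → E}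
    (hind : iIndepFun (fun s : (_ : ι) × ℕ => ψ s.1 s.2) μ) (hm : ∀ i j, Measurable (ψ i j))
    (hid : ∀ i j, IdentDistrib (ψ i j) (ψ i 0) μ μ) (hL : ∀ i, MemLp (ψ i 0) 2 μ) (t : E)
    (h0 : ∀ i, ∫ ω, inner ℝ (ψ i 0 ω) t ∂μ = 0) {N : ι → ℕ → ℕ} {a : ι → ℕ → ℝ} {v : ι → ℝ}
    (ha : ∀ i, Tendsto (a i) atTop (𝓝 0))
    (hv : ∀ i, Tendsto (fun ν => N i ν * a i ν ^ 2) atTop (𝓝 (v i))) :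
    Tendsto (fun ν => charFun
        (μ.map fun ω => ∑ i, a i ν • ∑ j ∈ Finset.range (N i ν), ψ i j ω) t) atTop
      (𝓝 (Complex.exp (-((∑ i, v i * ∫ ω, inner ℝ (ψ i 0 ω) t ^ 2 ∂μ : ℝ) : ℂ) / 2))) := by
  have hprod : ∀ ν, charFun
      (μ.map fun ω => ∑ i, a i ν • ∑ j ∈ Finset.range (N i ν), ψ i j ω) t
      = ∏ i, charFun (μ.map (ψ i 0)) (a i ν • t) ^ N i ν := by
    intro ν
    have hind' : iIndepFun (fun (s : (_ : ι) × ℕ) ω => a s.1 ν • ψ s.1 s.2 ω) μ :=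
      hind.comp (fun s x => a s.1 ν • x) fun s => measurable_const_smul _
    have h1 : (fun ω => ∑ i, a i ν • ∑ j ∈ Finset.range (N i ν), ψ i j ω)
        = fun ω => ∑ s ∈ Finset.univ.sigma fun i => Finset.range (N i ν),
          a s.1 ν • ψ s.1 s.2 ω := by
      funext ω
      rw [Finset.sum_sigma]
      exact Finset.sum_congr rfl fun i _ => Finset.smul_sum
    rw [h1, iIndepFun.charFun_map_fun_finsetSum_eq_prod
      (fun s _ => ((hm s.1 s.2).const_smul _).aemeasurable) (hind'.restrict _),
      Finset.prod_apply, Finset.prod_sigma]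
    refine Finset.prod_congr rfl fun i _ => ?_
    rw [← Finset.card_range (N i ν), ← Finset.prod_const, Finset.card_range]
    refine Finset.prod_congr rfl fun j _ => ?_
    rw [charFun_map_smul_comp (hm i j).aemeasurable, (hid i j).map_eq]
  simp_rw [hprod]
  have hlim : Complex.exp (-((∑ i, v i * ∫ ω, inner ℝ (ψ i 0 ω) t ^ 2 ∂μ : ℝ) : ℂ) / 2)
      = ∏ i, Complex.exp (-((v i * ∫ ω, inner ℝ (ψ i 0 ω) t ^ 2 ∂μ : ℝ) : ℂ) / 2) := by
    rw [← Complex.exp_sum, Complex.ofReal_sum, ← Finset.sum_neg_distrib, Finset.sum_div]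
  rw [hlim]
  exact tendsto_finsetProd _ fun i _ =>
    tendsto_charFun_smul_pow (hm i 0) (hL i) t (h0 i) (ha i) (hv i)

end CentralLimit

/-! ### Joint asymptotic normality of the estimators -/

/-- The quadratic form of the second moments of a square integrable random vector. -/
lemma integral_inner_sq {Ω : Type*} [MeasurableSpace Ω] {μ : Measure Ω} {n : ℕ} {X : Ω → Euc n}
    (hX : MemLp X 2 μ) (t : Euc n) :
    ∫ ω, inner ℝ (X ω) t ^ 2 ∂μ
      = WithLp.ofLp t ⬝ᵥ Matrix.of (fun r s => ∫ ω, X ω r * X ω s ∂μ) *ᵥ WithLp.ofLp t := by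
  have hc : ∀ r, MemLp (fun ω => X ω r) 2 μ := fun r => by
    have := hX.inner_const (𝕜 := ℝ) (EuclideanSpace.single r (1 : ℝ))
    simp only [EuclideanSpace.inner_single_right, conj_trivial, one_mul] at this
    exact this
  have hi : ∀ r s, Integrable (fun ω => X ω r * X ω s) μ := fun r s => (hc r).integrable_mul (hc s)
  have e : ∀ ω, inner ℝ (X ω) t ^ 2 = ∑ r, ∑ s, t r * t s * (X ω r * X ω s) := by
    intro ω
    rw [PiLp.inner_apply, sq, Finset.sum_mul_sum]
    refine Finset.sum_congr rfl fun r _ => Finset.sum_congr rfl fun s _ => ?_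
    simp only [RCLike.inner_apply, conj_trivial]
    ring
  simp_rw [e]
  rw [integral_finsetSum _ fun r _ => integrable_finsetSum _ fun s _ => (hi r s).const_mul _]
  simp only [dotProduct, Matrix.mulVec, Matrix.of_apply, Finset.mul_sum]
  refine Finset.sum_congr rfl fun r _ => ?_
  rw [integral_finsetSum _ fun s _ => (hi r s).const_mul _]
  refine Finset.sum_congr rfl fun s _ => ?_
  rw [integral_const_mul]
  ring

/-- For a positive semidefinite matrix, the squared norm of its root applied to a vector is its
quadratic form. -/
lemma norm_toEuclideanCLM_sqrt_sq {n : ℕ} {A : Matrix (Fin n) (Fin n) ℝ} (hA : A.PosSemidef)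
    (t : Euc n) :
    ‖Matrix.toEuclideanCLM (𝕜 := ℝ) (CFC.sqrt A) t‖ ^ 2
      = WithLp.ofLp t ⬝ᵥ A *ᵥ WithLp.ofLp t := by
  have hS := Matrix.nonneg_iff_posSemidef.1 (CFC.sqrt_nonneg A)
  have hSS : CFC.sqrt A * CFC.sqrt A = A := CFC.sqrt_mul_sqrt_self A hA.nonneg
  have hT : (CFC.sqrt A)ᵀ = CFC.sqrt A := by
    have := hS.isHermitian.eq
    rwa [Matrix.conjTranspose_eq_transpose_of_trivial] at this
  rw [← real_inner_self_eq_norm_sq, EuclideanSpace.inner_eq_star_dotProduct, star_trivial,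
    Matrix.ofLp_toEuclideanCLM]
  conv_rhs => rw [← hSS]
  rw [← Matrix.mulVec_mulVec, Matrix.dotProduct_mulVec, ← Matrix.mulVec_transpose, hT]
  exact dotProduct_comm _ _

lemma inner_toEuclideanCLM_sqrt {n : ℕ} (A : Matrix (Fin n) (Fin n) ℝ) (z t : Euc n) :
    inner ℝ (Matrix.toEuclideanCLM (𝕜 := ℝ) (CFC.sqrt A) z) t
      = inner ℝ z (Matrix.toEuclideanCLM (𝕜 := ℝ) (CFC.sqrt A) t) := by
  have hS := Matrix.nonneg_iff_posSemidef.1 (CFC.sqrt_nonneg A)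
  rw [← ContinuousLinearMap.adjoint_inner_right, ← ContinuousLinearMap.star_eq_adjoint, ← map_star]
  rw [Matrix.star_eq_conjTranspose, hS.isHermitian.eq]

/-- The root of the inverse of `S`, scaled by `√c`: the linear map by which a standard normal
vector is transformed in `gaussProcess`. -/
def gaussFactor {n : ℕ} (S : Matrix (Fin n) (Fin n) ℝ) (c : ℝ) : Euc n →L[ℝ] Euc n :=
  √c • Matrix.toEuclideanCLM (𝕜 := ℝ) (CFC.sqrt S⁻¹)

lemma charFun_map_gaussFactor {n : ℕ} {S : Matrix (Fin n) (Fin n) ℝ} (hS : S.PosSemidef) {c : ℝ}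
    (hc : 0 ≤ c) (t : Euc n) :
    ∫ z, Complex.exp ((inner ℝ (gaussFactor S c z) t : ℝ) * Complex.I) ∂(stdGaussian (Euc n))
      = Complex.exp (-((c * (WithLp.ofLp t ⬝ᵥ S⁻¹ *ᵥ WithLp.ofLp t) : ℝ) : ℂ) / 2) := by
  have h : ∀ z, inner ℝ (gaussFactor S c z) t = inner ℝ z (gaussFactor S c t) := by
    intro z
    simp only [gaussFactor, smul_apply, inner_smul_left, inner_smul_right,
      inner_toEuclideanCLM_sqrt, conj_trivial]
  simp_rw [h]
  rw [← charFun_apply, charFun_stdGaussian]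
  congr 2
  have h2 : ‖gaussFactor S c t‖ ^ 2 = c * (WithLp.ofLp t ⬝ᵥ S⁻¹ *ᵥ WithLp.ofLp t) := by
    rw [gaussFactor, smul_apply, norm_smul, mul_pow, norm_toEuclideanCLM_sqrt_sq hS.inv,
      Real.norm_eq_abs, sq_abs, Real.sq_sqrt hc]
  rw [← h2]
  push_cast
  ring

namespace TwoSample

variable {Ω : Type*} {d : ℕ} {p k : Fin 2 → ℕ} (R : TwoSample Ω d p k)

/-- The limits of `n / n_ℓ`. -/
def sizeRatio : Fin 2 → ℝ
  | 0 => R.κ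
  | 1 => R.κ / (R.κ - 1)

/-- The limit in distribution of the rescaled estimation errors of both groups, as a function of the
pair of standard normal vectors. -/
def limitVec (z : Euc (p 0) × Euc (p 1)) : (ℓ : Fin 2) → Euc (p ℓ) :=
  pairVec (gaussFactor (R.infoTrue 0) (R.sizeRatio 0) z.1)
    (gaussFactor (R.infoTrue 1) (R.sizeRatio 1) z.2)

lemma continuous_limitVec : Continuous R.limitVec :=
  continuous_pairVec.comp (((gaussFactor _ _).continuous.comp continuous_fst).prodMk
    ((gaussFactor _ _).continuous.comp continuous_snd))

/-- The rescaled errors `√n (β̂_ℓ - β_ℓ)` of the estimators of both groups. -/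
def scaledError (ν : ℕ) (ω : Ω) : PiLp 2 fun ℓ : Fin 2 => Euc (p ℓ) :=
  WithLp.toLp 2 (√(R.total ν) • ((fun ℓ => R.βHat ℓ ν ω) - R.β))

variable {R} [MeasurableSpace Ω] {μ : Measure Ω}

namespace Assumptions

lemma tendsto_size_real (hR : R.Assumptions μ) (ℓ : Fin 2) :
    Tendsto (fun ν => (R.size ℓ ν : ℝ)) atTop atTop :=
  tendsto_natCast_atTop_atTop.comp (hR.size_tendsto ℓ)

lemma tendsto_total_real (hR : R.Assumptions μ) : Tendsto (fun ν => (R.total ν : ℝ)) atTop atTop :=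
  tendsto_atTop_mono (fun ν => by simp [total]) (hR.tendsto_size_real 0)

lemma sizeRatio_pos (hR : R.Assumptions μ) (ℓ : Fin 2) : 0 < R.sizeRatio ℓ := by
  have := hR.one_lt_κ
  fin_cases ℓ
  · change 0 < R.κ
    linarith
  · change 0 < R.κ / (R.κ - 1)
    exact div_pos (by linarith) (by linarith)

lemma tendsto_total_div_size (hR : R.Assumptions μ) (ℓ : Fin 2) :
    Tendsto (fun ν => (R.total ν : ℝ) / R.size ℓ ν) atTop (𝓝 (R.sizeRatio ℓ)) := by
  fin_cases ℓ
  · exact hR.ratio_tendsto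
  · have h1 := hR.one_lt_κ
    have h2 := hR.ratio_tendsto.div (hR.ratio_tendsto.sub_const 1) (by linarith)
    refine h2.congr' ?_
    filter_upwards [(hR.tendsto_size_real 0).eventually_gt_atTop 0,
      (hR.tendsto_size_real 1).eventually_gt_atTop 0] with ν h3 h4
    simp only [total, Nat.cast_add, Pi.div_apply, Fin.mk_one]
    have h5 : ((R.size 0 ν : ℝ) + R.size 1 ν) / R.size 0 ν - 1 = R.size 1 ν / R.size 0 ν := by
      field_simp
      ring
    change ((R.size 0 ν : ℝ) + R.size 1 ν) / R.size 0 ν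
      / (((R.size 0 ν : ℝ) + R.size 1 ν) / R.size 0 ν - 1) = _
    rw [h5, div_div_div_cancel_right₀ h3.ne']

lemma posSemidef_infoMatrix {d p k : ℕ} {m : Euc d → Euc p → ℝ} {x : Fin k → Euc d}
    {w : Fin k → ℝ} {b : Euc p} {v : ℝ} (hw : ∀ i, 0 ≤ w i) (hv : 0 ≤ v) :
    (infoMatrix m x w b v).PosSemidef := by
  unfold infoMatrix
  refine Matrix.PosSemidef.smul (Matrix.posSemidef_sum _ fun i _ => ?_) (inv_nonneg.2 hv)
  refine Matrix.PosSemidef.smul ?_ (hw i)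
  have := Matrix.posSemidef_vecMulVec_self_star (WithLp.ofLp (∇ (m (x i)) b))
  rwa [star_trivial] at this

lemma posSemidef_infoTrue (hR : R.Assumptions μ) (ℓ : Fin 2) : (R.infoTrue ℓ).PosSemidef :=
  posSemidef_infoMatrix (fun i => (hR.ξ_pos ℓ i).le) (sq_nonneg _)

/-- The limit vector has independent Gaussian blocks with covariances `sizeRatio ℓ • Σ_ℓ⁻¹`. -/
lemma charFun_limitVec (hR : R.Assumptions μ) (t : PiLp 2 fun ℓ : Fin 2 => Euc (p ℓ)) :
    charFun (((stdGaussian (Euc (p 0))).prod (stdGaussian (Euc (p 1)))).map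
        fun z => WithLp.toLp 2 (R.limitVec z)) t
      = Complex.exp (-((∑ ℓ, R.sizeRatio ℓ *
          (WithLp.ofLp (t ℓ) ⬝ᵥ (R.infoTrue ℓ)⁻¹ *ᵥ WithLp.ofLp (t ℓ)) : ℝ) : ℂ) / 2) := by
  have hcont : Continuous fun z =>
      (WithLp.toLp 2 (R.limitVec z) : PiLp 2 fun ℓ : Fin 2 => Euc (p ℓ)) :=
    (PiLp.continuous_toLp 2 _).comp R.continuous_limitVec
  rw [charFun_apply, integral_map hcont.measurable.aemeasurable (by fun_prop)]
  have e : ∀ z : Euc (p 0) × Euc (p 1),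
      Complex.exp ((inner ℝ (WithLp.toLp 2 (R.limitVec z) : PiLp 2 fun ℓ : Fin 2 => Euc (p ℓ)) t
        : ℝ) * Complex.I)
      = Complex.exp ((inner ℝ (gaussFactor (R.infoTrue 0) (R.sizeRatio 0) z.1) (t 0) : ℝ)
          * Complex.I)
        * Complex.exp ((inner ℝ (gaussFactor (R.infoTrue 1) (R.sizeRatio 1) z.2) (t 1) : ℝ)
          * Complex.I) := by
    intro z
    rw [PiLp.inner_apply, Fin.sum_univ_two, ← Complex.exp_add, ← add_mul, Complex.ofReal_add]
    rfl
  simp_rw [e]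
  rw [integral_prod_mul
    (fun u => Complex.exp ((inner ℝ (gaussFactor (R.infoTrue 0) (R.sizeRatio 0) u) (t 0) : ℝ)
      * Complex.I))
    (fun u => Complex.exp ((inner ℝ (gaussFactor (R.infoTrue 1) (R.sizeRatio 1) u) (t 1) : ℝ)
      * Complex.I)),
    charFun_map_gaussFactor (hR.posSemidef_infoTrue 0) (hR.sizeRatio_pos 0).le,
    charFun_map_gaussFactor (hR.posSemidef_infoTrue 1) (hR.sizeRatio_pos 1).le,
    ← Complex.exp_add, Fin.sum_univ_two]
  congr 1
  push_cast
  ring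

lemma measurable_Y (hR : R.Assumptions μ) (ℓ : Fin 2) (i : Fin (k ℓ)) (j : ℕ) :
    Measurable (R.Y ℓ i j) :=
  (hR.measurable_error ℓ i j).const_add _

lemma measurable_scaledError (hR : R.Assumptions μ) (ν : ℕ) : Measurable (R.scaledError ν) := by
  refine (PiLp.continuous_toLp 2 _).measurable.comp (measurable_pi_iff.2 fun ℓ => ?_)
  exact ((hR.measurable_estimator ℓ ν).sub_const _).const_smul _

/-- The rescaled errors of the estimators of both groups converge jointly in distribution to a
Gaussian vector with independent blocks. -/
theorem tendstoInDistribution_scaledError [IsProbabilityMeasure μ] (hR : R.Assumptions μ) :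
    TendstoInDistribution R.scaledError atTop (fun z => WithLp.toLp 2 (R.limitVec z))
      (fun _ => μ) ((stdGaussian (Euc (p 0))).prod (stdGaussian (Euc (p 1)))) := by
  classical
  choose φ hφm hφL hφ0 hφcov hφ using hR.linearization
  -- influence vectors of both groups, embedded in the product space
  let ψ : ((ℓ : Fin 2) × Fin (k ℓ)) → ℕ → Ω → PiLp 2 fun ℓ : Fin 2 => Euc (p ℓ) :=
    fun s j ω => WithLp.toLp 2 (Pi.single s.1 (φ s.1 s.2 (R.Y s.1 s.2 j ω)))
  -- the weights are `√n / n_ℓ`, arranged so that their limits are visible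
  let a : ((ℓ : Fin 2) × Fin (k ℓ)) → ℕ → ℝ :=
    fun s ν => √((R.total ν : ℝ) / R.size s.1 ν) * (√(R.size s.1 ν))⁻¹
  have hsingle : ∀ ℓ : Fin 2, Continuous fun u : Euc (p ℓ) =>
      (WithLp.toLp 2 (Pi.single ℓ u) : PiLp 2 fun ℓ : Fin 2 => Euc (p ℓ)) := fun ℓ =>
    (PiLp.continuous_toLp 2 _).comp (continuous_single (A := fun ℓ : Fin 2 => Euc (p ℓ)) ℓ)
  have hinner : ∀ (s : (ℓ : Fin 2) × Fin (k ℓ)) (j : ℕ) (ω : Ω)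
      (t : PiLp 2 fun ℓ : Fin 2 => Euc (p ℓ)),
      inner ℝ (ψ s j ω) t = inner ℝ (φ s.1 s.2 (R.Y s.1 s.2 j ω)) (t s.1) := by
    intro s j ω t
    rw [PiLp.inner_apply, Finset.sum_eq_single s.1]
    · simp [ψ]
    · intro ℓ _ hℓ
      simp [ψ, Pi.single_eq_of_ne hℓ]
    · simp
  let G : ((ℓ : Fin 2) × Fin (k ℓ)) → ℝ → PiLp 2 fun ℓ : Fin 2 => Euc (p ℓ) :=
    fun s y => WithLp.toLp 2 (Pi.single s.1 (φ s.1 s.2 (R.m s.1 (R.x s.1 s.2) (R.β s.1) + y)))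
  have hGm : ∀ s, Measurable (G s) := fun s =>
    (hsingle s.1).measurable.comp ((hφm s.1 s.2).comp (measurable_const_add _))
  have hψm : ∀ s j, Measurable (ψ s j) := fun s j =>
    (hsingle s.1).measurable.comp ((hφm s.1 s.2).comp (hR.measurable_Y s.1 s.2 j))
  have hψind : iIndepFun (fun s : (_ : (ℓ : Fin 2) × Fin (k ℓ)) × ℕ => ψ s.1 s.2) μ := by
    have h1 := hR.indep.precomp (g := fun s : (_ : (ℓ : Fin 2) × Fin (k ℓ)) × ℕ =>
      (⟨s.1.1, s.1.2, s.2⟩ : (ℓ : Fin 2) × Fin (k ℓ) × ℕ)) (by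
        rintro ⟨⟨ℓ, i⟩, j⟩ ⟨⟨ℓ', i'⟩, j'⟩ h
        simp only [Sigma.mk.injEq] at h
        obtain ⟨rfl, h⟩ := h
        simp only [heq_eq_eq, Prod.mk.injEq] at h
        obtain ⟨rfl, rfl⟩ := h
        rfl)
    exact h1.comp (fun s => G s.1) fun s => hGm s.1
  have hψid : ∀ s j, IdentDistrib (ψ s j) (ψ s 0) μ μ := fun s j =>
    (hR.ident s.1 s.2 j s.2 0).comp (hGm s)
  have hψL : ∀ s, MemLp (ψ s 0) 2 μ := fun s => by
    refine (hφL s.1 s.2 0).of_le (hψm s 0).aestronglyMeasurable (Eventually.of_forall fun ω => ?_)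
    refine le_of_eq ?_
    simp only [ψ]
    exact PiLp.norm_single 2 _ _ _
  have hψ0 : ∀ s (t : PiLp 2 fun ℓ : Fin 2 => Euc (p ℓ)), ∫ ω, inner ℝ (ψ s 0 ω) t ∂μ = 0 := by
    intro s t
    simp_rw [hinner, real_inner_comm (t s.1)]
    rw [integral_inner ((hφL s.1 s.2 0).integrable one_le_two), hφ0, inner_zero_right]
  have ha : ∀ s, Tendsto (a s) atTop (𝓝 0) := fun s => by
    have h1 := ((Real.continuous_sqrt.tendsto _).comp (hR.tendsto_total_div_size s.1)).mul
      (tendsto_inv_atTop_zero.comp (Real.tendsto_sqrt_atTop.comp (hR.tendsto_size_real s.1)))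
    rw [mul_zero] at h1
    exact h1
  have hv : ∀ s : (ℓ : Fin 2) × Fin (k ℓ),
      Tendsto (fun ν => (R.num s.1 s.2 ν : ℝ) * a s ν ^ 2) atTop
        (𝓝 (R.sizeRatio s.1 * R.ξ s.1 s.2)) := fun s => by
    refine ((hR.tendsto_total_div_size s.1).mul (hR.weight_tendsto s.1 s.2)).congr fun ν => ?_
    simp only [a]
    rw [mul_pow, inv_pow, Real.sq_sqrt (by positivity), Real.sq_sqrt (by positivity)]
    ring
  -- the linearized errors converge by Lévy's theorem
  have hV : TendstoInDistribution
      (fun ν ω => ∑ s, a s ν • ∑ j ∈ Finset.range (R.num s.1 s.2 ν), ψ s j ω) atTop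
      (fun z => WithLp.toLp 2 (R.limitVec z)) (fun _ => μ)
      ((stdGaussian (Euc (p 0))).prod (stdGaussian (Euc (p 1)))) := by
    refine ⟨fun ν => ?_, ?_, ?_⟩
    · refine Measurable.aemeasurable ?_
      exact Finset.measurable_fun_sum _ fun s _ =>
        (Finset.measurable_fun_sum _ fun j _ => hψm s j).const_smul (a s ν)
    · exact ((PiLp.continuous_toLp 2 _).comp R.continuous_limitVec).measurable.aemeasurable
    · refine ProbabilityMeasure.tendsto_iff_tendsto_charFun.2 fun t => ?_
      simp only [ProbabilityMeasure.coe_mk]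
      rw [hR.charFun_limitVec]
      have h1 := tendsto_charFun_sum_samples hψind hψm hψid hψL t (fun s => hψ0 s t)
        (N := fun s => R.num s.1 s.2) ha hv
      convert h1 using 6
      rw [Fintype.sum_sigma]
      refine Finset.sum_congr rfl fun ℓ _ => ?_
      simp_rw [hinner, integral_inner_sq (hφL ℓ _ 0)]
      rw [hφcov ℓ 0, Matrix.sum_mulVec, dotProduct_sum, Finset.mul_sum]
      refine Finset.sum_congr rfl fun i _ => ?_
      rw [Matrix.smul_mulVec, dotProduct_smul, smul_eq_mul, mul_assoc]
  refine tendstoInDistribution_of_tendstoInMeasure_sub _ _ hV ?_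
    fun ν => (hR.measurable_scaledError ν).aemeasurable
  refine tendstoInMeasure_of_tendsto_inProb ?_
  -- the remainder is the one of the linearization, times `√(n / n_ℓ)`, which converges
  have hcoord : ∀ ℓ, Tendsto (fun q : ℕ × Ω => √((R.total q.1 : ℝ) / R.size ℓ q.1) •
      (√(R.size ℓ q.1) • (R.βHat ℓ q.1 q.2 - R.β ℓ) - (√(R.size ℓ q.1))⁻¹ • ∑ i,
        ∑ j ∈ Finset.range (R.num ℓ i q.1), φ ℓ i (R.Y ℓ i j q.2))) (inProb μ) (𝓝 0) := by
    intro ℓ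
    have h1 := (((Real.continuous_sqrt.tendsto _).comp (hR.tendsto_total_div_size ℓ)).comp
      (tendsto_fst_inProb (μ := μ))).smul (hφ ℓ).tendsto_inProb
    rw [smul_zero] at h1
    exact h1
  have hpi := ((PiLp.continuous_toLp 2 fun ℓ : Fin 2 => Euc (p ℓ)).tendsto 0).comp
    (tendsto_pi_nhds.2 hcoord)
  refine hpi.congr' ?_
  have hpos : ∀ᶠ q : ℕ × Ω in inProb μ, ∀ ℓ, (0 : ℝ) < R.size ℓ q.1 :=
    tendsto_fst_inProb.eventually
      (eventually_all.2 fun ℓ => (hR.tendsto_size_real ℓ).eventually_gt_atTop 0)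
  filter_upwards [hpos] with q hq
  ext ℓ : 1
  have hsq : √((R.total q.1 : ℝ) / R.size ℓ q.1) * √(R.size ℓ q.1) = √(R.total q.1) := by
    rw [← Real.sqrt_mul (by positivity), div_mul_cancel₀ _ (hq ℓ).ne']
  have hsum : (∑ s, a s q.1 • ∑ j ∈ Finset.range (R.num s.1 s.2 q.1), ψ s j q.2) ℓ
      = ∑ i, a ⟨ℓ, i⟩ q.1 • ∑ j ∈ Finset.range (R.num ℓ i q.1), φ ℓ i (R.Y ℓ i j q.2) := by
    rw [Fintype.sum_sigma]
    simp only [WithLp.ofLp_sum, WithLp.ofLp_smul, Finset.sum_apply, Pi.smul_apply, ψ]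
    rw [Finset.sum_eq_single ℓ]
    · simp
    · intro ℓ' _ hne
      simp [Pi.single_eq_of_ne hne.symm]
    · simp
  simp only [Function.comp_apply, Pi.sub_apply, PiLp.sub_apply, hsum]
  rw [smul_sub, smul_smul, hsq, smul_smul, Finset.smul_sum]
  rfl

end Assumptions

end TwoSample

/-! ### Consistency of the plug-in quantiles and asymptotics of the test -/

/-- Nonsingularity of the limit is what makes inversion continuous there. -/
lemma tendsto_gaussFactor {ι : Type*} {l : Filter ι} {n : ℕ} {S : ι → Matrix (Fin n) (Fin n) ℝ}
    {S₀ : Matrix (Fin n) (Fin n) ℝ} (hpsd : ∀ᶠ i in l, (S i).PosSemidef) (hpsd₀ : S₀.PosSemidef)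
    (hdet : IsUnit S₀.det) (hS : Tendsto S l (𝓝 S₀)) {c : ι → ℝ} {c₀ : ℝ}
    (hc : Tendsto c l (𝓝 c₀)) :
    Tendsto (fun i => gaussFactor (S i) (c i)) l (𝓝 (gaussFactor S₀ c₀)) := by
  have hinv : Tendsto (fun i => (S i)⁻¹) l (𝓝 S₀⁻¹) := by
    have h1 : ContinuousAt Ring.inverse S₀.det := by
      rw [Ring.inverse_eq_inv']
      exact continuousAt_inv₀ hdet.ne_zero
    exact (continuousAt_matrix_inv S₀ h1).tendsto.comp hS
  have hsqrt := Matrix.PosSemidef.tendsto_sqrt (hpsd.mono fun i hi => hi.inv) hpsd₀.inv hinv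
  have hcont : Continuous (Matrix.toEuclideanCLM (𝕜 := ℝ) (n := Fin n)) :=
    LinearMap.continuous_of_finiteDimensional
      ((Matrix.toEuclideanCLM (𝕜 := ℝ) (n := Fin n)).toAlgEquiv.toLinearMap)
  exact ((Real.continuous_sqrt.tendsto c₀).comp hc).smul ((hcont.tendsto _).comp hsqrt)

namespace TwoSample

variable {Ω : Type*} {d : ℕ} {p k : Fin 2 → ℕ} (R : TwoSample Ω d p k)

lemma gaussProcess_eq_tangent (b : (ℓ : Fin 2) → Euc (p ℓ))
    (S₀ : Matrix (Fin (p 0)) (Fin (p 0)) ℝ) (S₁ : Matrix (Fin (p 1)) (Fin (p 1)) ℝ) (κ : ℝ)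
    (z : Euc (p 0) × Euc (p 1)) :
    gaussProcess (R.m 0) (R.m 1) (b 0) (b 1) S₀ S₁ κ z
      = R.tangent b (pairVec (gaussFactor S₀ κ z.1) (gaussFactor S₁ (κ / (κ - 1)) z.2)) := by
  funext x
  simp only [gaussProcess, inner_gradient_eq_fderiv]
  rfl

lemma THat_eq (c : ℝ) (ν : ℕ) (ω : Ω) :
    R.THat c ν ω = fun z => signedArea R.X (R.zeroSetHat c ν ω)
      (R.curveDiff fun ℓ => R.βHat ℓ ν ω) (R.tangent (fun ℓ => R.βHat ℓ ν ω)
        (pairVec (gaussFactor (R.infoHat 0 ν ω) ((R.total ν : ℝ) / R.size 0 ν) z.1)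
          (gaussFactor (R.infoHat 1 ν ω) (((R.total ν : ℝ) / R.size 0 ν)
            / ((R.total ν : ℝ) / R.size 0 ν - 1)) z.2))) := by
  funext z
  rw [THat, R.gaussProcess_eq_tangent fun ℓ => R.βHat ℓ ν ω]
  rfl

lemma T_eq_dirDeriv : R.T = fun z => R.dirDeriv (R.limitVec z) := by
  funext z
  rw [T, gaussProcess_eq_tangent]
  rfl

variable {R}

lemma Assumptions.eventually_norm_smul_le_of_norm_scaledError_le {l : Filter (ℕ × Ω)} (M : ℝ) :
    ∀ᶠ q : ℕ × Ω in l ⊓ 𝓟 {q | ‖R.scaledError q.1 q.2‖ ≤ M},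
      ‖√(R.total q.1 : ℝ) • ((fun ℓ => R.βHat ℓ q.1 q.2) - R.β)‖ ≤ M := by
  refine eventually_inf_principal.2 (Eventually.of_forall fun q hq => ?_)
  have hq' : ‖R.scaledError q.1 q.2‖ ≤ M := hq
  refine (pi_norm_le_iff_of_nonneg ((norm_nonneg _).trans hq')).2 fun ℓ => ?_
  exact (PiLp.norm_apply_le (R.scaledError q.1 q.2) ℓ).trans hq'

variable [MeasurableSpace Ω] {μ : Measure Ω}

namespace Assumptions

lemma continuous_T (hR : R.Assumptions μ) : Continuous R.T := by
  rw [T_eq_dirDeriv]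
  exact hR.continuous_dirDeriv.comp R.continuous_limitVec

lemma measurable_THat (hR : R.Assumptions μ) (c : ℝ) (ν : ℕ) (ω : Ω) :
    Measurable (R.THat c ν ω) := by
  have hb : ∀ ℓ, R.βHat ℓ ν ω ∈ R.B ℓ := fun ℓ => hR.estimator_mem ℓ ν ω
  have hA : MeasurableSet (R.zeroSetHat c ν ω) :=
    measurableSet_sep_of_continuousOn
      (P := fun t => |t| < c * √(Real.log (R.total ν) / R.total ν))
      (isOpen_lt continuous_abs continuous_const).measurableSet hR.compact_region
      (hR.continuousOn_curveDiff hb)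
  have h1 := hR.continuous_signedArea_tangent hb hA (Set.sep_subset _ _)
    (hR.continuousOn_curveDiff hb)
  rw [R.THat_eq]
  refine (h1.comp (continuous_pairVec.comp (Continuous.prodMk ?_ ?_))).measurable
  · exact (gaussFactor _ _).continuous.comp continuous_fst
  · exact (gaussFactor _ _).continuous.comp continuous_snd

lemma tendsto_sqrt_total (hR : R.Assumptions μ) :
    Tendsto (fun q : ℕ × Ω => √(R.total q.1 : ℝ)) (inProb μ) atTop :=
  (Real.tendsto_sqrt_atTop.comp hR.tendsto_total_real).comp tendsto_fst_inProb

lemma eventually_posSemidef_infoHat (hR : R.Assumptions μ) (ℓ : Fin 2) :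
    ∀ᶠ q : ℕ × Ω in inProb μ, (R.infoHat ℓ q.1 q.2).PosSemidef := by
  filter_upwards [(hR.variance_consistent ℓ).tendsto_inProb.eventually_const_lt
    (pow_pos (hR.sigma_pos ℓ) 2)] with q hq
  exact posSemidef_infoMatrix (fun i => by positivity) hq.le

lemma isProbabilityMeasure_lawT (hR : R.Assumptions μ) : IsProbabilityMeasure R.lawT :=
  Measure.isProbabilityMeasure_map hR.continuous_T.measurable.aemeasurable

section Stochastic

variable [IsProbabilityMeasure μ]

lemma stochBounded_scaledError (hR : R.Assumptions μ) : StochBounded μ R.scaledError :=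
  hR.tendstoInDistribution_scaledError.stochBounded

lemma tendsto_estimator (hR : R.Assumptions μ) :
    Tendsto (fun q : ℕ × Ω => fun ℓ => R.βHat ℓ q.1 q.2) (inProb μ) (𝓝 R.β) :=
  hR.stochBounded_scaledError.tendsto_inProb fun M =>
    tendsto_of_norm_smul_sub_le (hR.tendsto_sqrt_total.mono_left inf_le_left)
      (eventually_norm_smul_le_of_norm_scaledError_le M)

/-- The first order expansion of the plug-in area. -/
lemma tendsto_smul_distHat_sub (hR : R.Assumptions μ) :
    Tendsto (fun q : ℕ × Ω => √(R.total q.1 : ℝ) * (R.distHat q.1 q.2 - R.dist)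
      - R.dirDeriv (WithLp.ofLp (R.scaledError q.1 q.2))) (inProb μ) (𝓝 0) := by
  refine hR.stochBounded_scaledError.tendsto_inProb fun M => ?_
  have hr : Tendsto (fun q : ℕ × Ω => √(R.total q.1 : ℝ))
      (inProb μ ⊓ 𝓟 {q | ‖R.scaledError q.1 q.2‖ ≤ M}) atTop :=
    hR.tendsto_sqrt_total.mono_left inf_le_left
  have hM := eventually_norm_smul_le_of_norm_scaledError_le (R := R) (l := inProb μ) M
  have key := hR.tendsto_smul_areaBetween_sub (M := M) hr
    (b := fun q ℓ => R.βHat ℓ q.1 q.2) fun q ℓ => hR.estimator_mem ℓ q.1 q.2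
  beta_reduce at key
  exact key hM

lemma tendstoInDistribution_dirDeriv (hR : R.Assumptions μ) :
    TendstoInDistribution (fun ν ω => R.dirDeriv (WithLp.ofLp (R.scaledError ν ω))) atTop R.T
      (fun _ => μ) ((stdGaussian (Euc (p 0))).prod (stdGaussian (Euc (p 1)))) := by
  have h := hR.tendstoInDistribution_scaledError.continuous_comp
    (g := fun w : PiLp 2 fun ℓ : Fin 2 => Euc (p ℓ) => R.dirDeriv (WithLp.ofLp w))
    (hR.continuous_dirDeriv.comp (PiLp.continuous_ofLp 2 _))
  rw [T_eq_dirDeriv]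
  exact h

lemma tendsto_infoHat (hR : R.Assumptions μ) (ℓ : Fin 2) :
    Tendsto (fun q : ℕ × Ω => R.infoHat ℓ q.1 q.2) (inProb μ) (𝓝 (R.infoTrue ℓ)) := by
  have hb : Tendsto (fun q : ℕ × Ω => R.βHat ℓ q.1 q.2) (inProb μ) (𝓝 (R.β ℓ)) :=
    tendsto_pi_nhds.1 hR.tendsto_estimator ℓ
  have hgrad : ∀ i, Tendsto (fun q : ℕ × Ω =>
      WithLp.ofLp (∇ (R.m ℓ (R.x ℓ i)) (R.βHat ℓ q.1 q.2))) (inProb μ)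
      (𝓝 (WithLp.ofLp (∇ (R.m ℓ (R.x ℓ i)) (R.β ℓ)))) := fun i => by
    have h1 : ContinuousOn (fun b => fderiv ℝ (R.m ℓ (R.x ℓ i)) b) (R.B ℓ) :=
      (hR.continuous_deriv ℓ).comp (f := fun b => (R.x ℓ i, b)) (by fun_prop)
        fun b hb => ⟨hR.covariate_mem ℓ i, hb⟩
    have h2 := (h1.continuousAt (mem_interior_iff_mem_nhds.1 (hR.true_param_mem ℓ))).tendsto.comp hb
    have h3 := ((InnerProductSpace.toDual ℝ (Euc (p ℓ))).symm.continuous.tendsto _).comp h2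
    exact ((PiLp.continuous_ofLp 2 fun _ : Fin (p ℓ) => ℝ).tendsto _).comp h3
  have hw : ∀ i, Tendsto (fun q : ℕ × Ω => (R.num ℓ i q.1 : ℝ) / R.size ℓ q.1) (inProb μ)
      (𝓝 (R.ξ ℓ i)) := fun i => (hR.weight_tendsto ℓ i).comp tendsto_fst_inProb
  have hσ := (hR.variance_consistent ℓ).tendsto_inProb.inv₀
    (pow_pos (hR.sigma_pos ℓ) 2).ne'
  refine hσ.smul (tendsto_finsetSum _ fun i _ => (hw i).smul ?_)
  have hvec : Continuous fun u : Fin (p ℓ) → ℝ => Matrix.vecMulVec u u :=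
    continuous_id.matrix_vecMulVec continuous_id
  exact (hvec.tendsto _).comp (hgrad i)

/-- With probability tending to one, the plug-in functional is close to the limit functional,
uniformly relative to the norm of the Gaussian vector. -/
lemma eventually_abs_THat_sub_le (hR : R.Assumptions μ) {c : ℝ} (hc : 0 < c) {δ : ℝ} (hδ : 0 < δ) :
    ∀ᶠ q : ℕ × Ω in inProb μ, ∀ z, |R.THat c q.1 q.2 z - R.T z| ≤ δ * ‖z‖ := by
  have hratio : Tendsto (fun q : ℕ × Ω => (R.total q.1 : ℝ) / R.size 0 q.1) (inProb μ) (𝓝 R.κ) :=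
    hR.ratio_tendsto.comp tendsto_fst_inProb
  have hκ := hR.one_lt_κ
  have hL₀ := tendsto_gaussFactor (hR.eventually_posSemidef_infoHat 0) (hR.posSemidef_infoTrue 0)
    (hR.info_nonsingular 0) (hR.tendsto_infoHat 0) hratio
  have hL₁ := tendsto_gaussFactor (hR.eventually_posSemidef_infoHat 1) (hR.posSemidef_infoTrue 1)
    (hR.info_nonsingular 1) (hR.tendsto_infoHat 1)
    (hratio.div (hratio.sub_const 1) (by linarith))
  have hn : Tendsto (fun q : ℕ × Ω => (R.total q.1 : ℝ)) (inProb μ) atTop :=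
    hR.tendsto_total_real.comp tendsto_fst_inProb
  have hs : Tendsto (fun q : ℕ × Ω => c * √(Real.log (R.total q.1) / R.total q.1)) (inProb μ)
      (𝓝 0) := by
    have h1 := (Real.continuous_sqrt.tendsto 0).comp
      (Real.isLittleO_log_id_atTop.tendsto_div_nhds_zero.comp hn)
    rw [Real.sqrt_zero] at h1
    have h2 := h1.const_mul c
    rw [mul_zero] at h2
    exact h2
  have hrs : Tendsto (fun q : ℕ × Ω => √(R.total q.1 : ℝ)
      * (c * √(Real.log (R.total q.1) / R.total q.1))) (inProb μ) atTop := by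
    have h1 := (Real.tendsto_sqrt_atTop.comp (Real.tendsto_log_atTop.comp hn)).const_mul_atTop hc
    refine h1.congr' ?_
    filter_upwards [hn.eventually_gt_atTop 0] with q hq
    simp only [Function.comp_apply]
    rw [mul_left_comm, ← Real.sqrt_mul hq.le, mul_div_cancel₀ _ hq.ne']
  suffices h : Tendsto id (inProb μ)
      (𝓟 {q : ℕ × Ω | ∀ z, |R.THat c q.1 q.2 z - R.T z| ≤ δ * ‖z‖}) from tendsto_principal.1 h
  refine hR.stochBounded_scaledError.tendsto_inProb fun M => tendsto_principal.2 ?_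
  have hr : Tendsto (fun q : ℕ × Ω => √(R.total q.1 : ℝ))
      (inProb μ ⊓ 𝓟 {q | ‖R.scaledError q.1 q.2‖ ≤ M}) atTop :=
    hR.tendsto_sqrt_total.mono_left inf_le_left
  have hM := eventually_norm_smul_le_of_norm_scaledError_le (R := R) (l := inProb μ) M
  have key := hR.eventually_abs_signedArea_sub_dirDeriv_le (M := M) hr
    (b := fun q ℓ => R.βHat ℓ q.1 q.2) fun q ℓ => hR.estimator_mem ℓ q.1 q.2
  beta_reduce at key
  replace key := key hM (hs.mono_left inf_le_left)
    (hrs.mono_left inf_le_left) (hL₀.mono_left inf_le_left) (hL₁.mono_left inf_le_left) hδ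
  filter_upwards [key] with q hq z
  rw [T_eq_dirDeriv, THat_eq]
  exact hq z

/-- Consistency of the conditional quantiles. -/
lemma tendsto_qHat (hR : R.Assumptions μ) {c : ℝ} (hc : 0 < c) {α : ℝ} (h₀ : 0 < α) (h₁ : α < 1) :
    Tendsto (fun q : ℕ × Ω => R.qHat c α q.1 q.2) (inProb μ) (𝓝 (quantile R.lawT α)) := by
  rw [Metric.tendsto_nhds]
  intro ε hε
  obtain ⟨δ, hδ, h⟩ := exists_forall_abs_quantile_sub_le
    (γ := (stdGaussian (Euc (p 0))).prod (stdGaussian (Euc (p 1)))) hR.continuous_T h₀ h₁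
    (half_pos hε)
  filter_upwards [hR.eventually_abs_THat_sub_le hc hδ] with q hq
  rw [Real.dist_eq]
  exact lt_of_le_of_lt (h _ (hR.measurable_THat c q.1 q.2) hq) (half_lt_self hε)

lemma tendsto_distHat (hR : R.Assumptions μ) :
    Tendsto (fun q : ℕ × Ω => R.distHat q.1 q.2) (inProb μ) (𝓝 R.dist) := by
  have hr := hR.tendsto_sqrt_total
  have h1 : Tendsto (fun q : ℕ × Ω => (√(R.total q.1 : ℝ))⁻¹
      * R.dirDeriv (WithLp.ofLp (R.scaledError q.1 q.2))) (inProb μ) (𝓝 0) := by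
    refine hR.tendstoInDistribution_dirDeriv.stochBounded.tendsto_inProb fun M => ?_
    refine (tendsto_inv_atTop_zero.comp (hr.mono_left inf_le_left)).zero_mul_isBoundedUnder_le ?_
    exact isBoundedUnder_of_eventually_le (a := M)
      (eventually_inf_principal.2 (Eventually.of_forall fun q hq => hq))
  have h2 := ((tendsto_inv_atTop_zero.comp hr).mul hR.tendsto_smul_distHat_sub).add h1
  rw [mul_zero, zero_add] at h2
  have h3 := h2.add_const R.dist
  rw [zero_add] at h3
  refine h3.congr' ?_
  filter_upwards [hr.eventually_gt_atTop 0] with q hq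
  simp only [Function.comp_apply]
  field_simp
  ring

/-- Asymptotic bound for events on which the rescaled error of the area is at most the estimated
quantile. -/
lemma eventually_measureReal_le_of_le_qHat (hR : R.Assumptions μ) {c : ℝ} (hc : 0 < c) {α : ℝ}
    (h₀ : 0 < α) (h₁ : α < 1) (hcont : ContinuousAt (cdf R.lawT) (quantile R.lawT α))
    {A : ℕ → Set Ω} (hA : ∀ᶠ q in inProb μ, q.2 ∈ A q.1 →
      √(R.total q.1 : ℝ) * (R.distHat q.1 q.2 - R.dist) ≤ R.qHat c α q.1 q.2)
    {e : ℝ} (he : 0 < e) : ∀ᶠ ν in atTop, μ.real (A ν) ≤ α + e := by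
  have hP := hR.isProbabilityMeasure_lawT
  have hq := cdf_quantile_of_continuousAt h₀ h₁ hcont
  have h2 := hcont.tendsto.eventually_lt_const (u := α + e / 2) (by linarith)
  obtain ⟨δ, hδ, hball⟩ := Metric.eventually_nhds_iff.1 h2
  have h3 : cdf R.lawT (quantile R.lawT α + δ / 2) < α + e / 2 := hball (by
    rw [Real.dist_eq, add_sub_cancel_left, abs_of_pos (by positivity)]
    linarith)
  rw [cdf_eq_real] at h3
  have h4 := hR.tendstoInDistribution_dirDeriv.eventually_measureReal_le
    (isClosed_Iic (a := quantile R.lawT α + δ / 2)) (A := A) (by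
      have e1 := hR.tendsto_smul_distHat_sub.eventually_const_lt (u := -(δ / 4)) (by linarith)
      have e2 := (hR.tendsto_qHat hc h₀ h₁).eventually_lt_const
        (u := quantile R.lawT α + δ / 4) (by linarith)
      filter_upwards [hA, e1, e2] with q q1 q2 q3 q4
      have := q1 q4
      rw [Set.mem_Iic]
      linarith) (half_pos he)
  filter_upwards [h4] with ν h5
  change _ ≤ R.lawT.real _ + _ at h5
  linarith

/-- Asymptotic bound for events on which the rescaled error of the area is at least the estimated
quantile. -/
lemma eventually_measureReal_le_of_qHat_le (hR : R.Assumptions μ) {c : ℝ} (hc : 0 < c) {α : ℝ}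
    (h₀ : 0 < α) (h₁ : α < 1) (hcont : ContinuousAt (cdf R.lawT) (quantile R.lawT α))
    {A : ℕ → Set Ω} (hA : ∀ᶠ q in inProb μ, q.2 ∈ A q.1 →
      R.qHat c α q.1 q.2 ≤ √(R.total q.1 : ℝ) * (R.distHat q.1 q.2 - R.dist))
    {e : ℝ} (he : 0 < e) : ∀ᶠ ν in atTop, μ.real (A ν) ≤ 1 - α + e := by
  have hP := hR.isProbabilityMeasure_lawT
  have hq := cdf_quantile_of_continuousAt h₀ h₁ hcont
  have h2 := hcont.tendsto.eventually_const_lt (u := α - e / 2) (by linarith)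
  obtain ⟨δ, hδ, hball⟩ := Metric.eventually_nhds_iff.1 h2
  have h3 : α - e / 2 < cdf R.lawT (quantile R.lawT α - δ / 2) := hball (by
    rw [Real.dist_eq, sub_sub_cancel_left, abs_neg, abs_of_pos (by positivity)]
    linarith)
  rw [cdf_eq_real] at h3
  have hset : R.lawT.real (Set.Ici (quantile R.lawT α - δ / 4))
      ≤ 1 - R.lawT.real (Set.Iic (quantile R.lawT α - δ / 2)) := by
    rw [← probReal_compl_eq_one_sub measurableSet_Iic]
    refine measureReal_mono fun t ht => ?_
    rw [Set.compl_Iic, Set.mem_Ioi]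
    have : quantile R.lawT α - δ / 4 ≤ t := ht
    linarith
  have h4 := hR.tendstoInDistribution_dirDeriv.eventually_measureReal_le
    (isClosed_Ici (a := quantile R.lawT α - δ / 4)) (A := A) (by
      have e1 := hR.tendsto_smul_distHat_sub.eventually_lt_const (u := δ / 8) (by linarith)
      have e2 := (hR.tendsto_qHat hc h₀ h₁).eventually_const_lt
        (u := quantile R.lawT α - δ / 8) (by linarith)
      filter_upwards [hA, e1, e2] with q q1 q2 q3 q4
      have := q1 q4
      rw [Set.mem_Ici]
      linarith) (half_pos he)
  filter_upwards [h4] with ν h5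
  change _ ≤ R.lawT.real _ + _ at h5
  linarith

end Stochastic

end Assumptions

end TwoSample

lemma one_sub_measureReal_compl_le {Ω : Type*} [MeasurableSpace Ω] (μ : Measure Ω)
    [IsProbabilityMeasure μ] (A : Set Ω) : 1 - μ.real Aᶜ ≤ μ.real A := by
  have h := measureReal_union_le (μ := μ) A Aᶜ
  rw [Set.union_compl_self, probReal_univ] at h
  linarith

lemma tendsto_measureReal_zero_of_inProb {Ω : Type*} [MeasurableSpace Ω] {μ : Measure Ω}
    {A : ℕ → Set Ω} (h : ∀ᶠ q in inProb μ, q.2 ∉ A q.1) :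
    Tendsto (fun ν => μ.real (A ν)) atTop (𝓝 0) := by
  have h1 := (ENNReal.tendsto_toReal ENNReal.zero_ne_top).comp (eventually_inProb.1 h)
  simpa [Function.comp_def, Measure.real] using h1

theorem theorem2p2 {Ω : Type*} [MeasurableSpace Ω] (μ : Measure Ω) [IsProbabilityMeasure μ]
    {d : ℕ} {p k : Fin 2 → ℕ} (R : TwoSample Ω d p k) (hR : R.Assumptions μ)
    (α : ℝ) (hα₀ : 0 < α) (hα₁ : α < 1) (c : ℝ) (hc : 0 < c) :
    (ContinuousAt (cdf R.lawT) (quantile R.lawT α) →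
      Tendsto (fun ν => μ.real {ω | R.dist ∈ R.confInterval c α ν ω}) atTop (𝓝 (1 - α))) ∧
    ∀ ε : ℝ, 0 < ε →
      (ε ≤ R.dist → (R.dist = ε → ContinuousAt (cdf R.lawT) (quantile R.lawT α)) →
        limsup (fun ν => μ.real (R.rejects c α ε ν)) atTop ≤ α) ∧
      (R.dist < ε → liminf (fun ν => μ.real (R.rejects c α ε ν)) atTop = 1) := by
  have hpos : ∀ᶠ q : ℕ × Ω in inProb μ, 0 < √(R.total q.1 : ℝ) :=
    hR.tendsto_sqrt_total.eventually_gt_atTop 0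
  have hquot : Tendsto (fun q : ℕ × Ω => R.qHat c α q.1 q.2 / √(R.total q.1 : ℝ)) (inProb μ)
      (𝓝 0) := (hR.tendsto_qHat hc hα₀ hα₁).div_atTop hR.tendsto_sqrt_total
  have hdist0 : 0 ≤ R.dist := integral_nonneg fun x => abs_nonneg _
  refine ⟨fun hcont => ?_, fun ε hε => ⟨fun hle hcont => ?_, fun hlt => ?_⟩⟩
  · rw [Metric.tendsto_nhds]
    intro e he
    -- outer probability is only subadditive, so the lower bound comes from the complement
    have hup := hR.eventually_measureReal_le_of_qHat_le hc hα₀ hα₁ hcont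
      (A := fun ν => {ω | R.dist ∈ R.confInterval c α ν ω}) (by
        filter_upwards [hpos] with q hq hmem
        have h1 : R.dist < R.distHat q.1 q.2 - R.qHat c α q.1 q.2 / √(R.total q.1) := hmem.2
        have h2 := (div_lt_iff₀ hq).1 (show R.qHat c α q.1 q.2 / √(R.total q.1 : ℝ)
          < R.distHat q.1 q.2 - R.dist by linarith)
        linarith) (half_pos he)
    have hlo := hR.eventually_measureReal_le_of_le_qHat hc hα₀ hα₁ hcont
      (A := fun ν => {ω | R.dist ∈ R.confInterval c α ν ω}ᶜ) (by
        filter_upwards [hpos] with q hq hmem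
        have h1 : ¬ R.dist < R.distHat q.1 q.2 - R.qHat c α q.1 q.2 / √(R.total q.1) :=
          fun h => hmem ⟨hdist0, h⟩
        have h2 := (le_div_iff₀ hq).1 (show R.distHat q.1 q.2 - R.dist
          ≤ R.qHat c α q.1 q.2 / √(R.total q.1 : ℝ) by linarith)
        linarith) (half_pos he)
    filter_upwards [hup, hlo] with ν h1 h2
    have h3 := one_sub_measureReal_compl_le μ {ω | R.dist ∈ R.confInterval c α ν ω}
    rw [Real.dist_eq, abs_lt]
    constructor <;> linarith
  · have hbdd : IsCoboundedUnder (· ≤ ·) atTop fun ν => μ.real (R.rejects c α ε ν) :=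
      isCoboundedUnder_le_of_le atTop (x := 0) fun ν => measureReal_nonneg
    rcases hle.eq_or_lt with heq | hlt
    · refine le_of_forall_pos_le_add fun e he => limsup_le_of_le hbdd ?_
      refine hR.eventually_measureReal_le_of_le_qHat hc hα₀ hα₁ (hcont heq.symm) ?_ he
      filter_upwards [hpos] with q hq hmem
      have h1 : R.distHat q.1 q.2 < ε + R.qHat c α q.1 q.2 / √(R.total q.1) := hmem
      have h2 := (le_div_iff₀ hq).1 (show R.distHat q.1 q.2 - R.dist
        ≤ R.qHat c α q.1 q.2 / √(R.total q.1 : ℝ) by linarith)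
      linarith
    · have h0 := tendsto_measureReal_zero_of_inProb (μ := μ) (A := R.rejects c α ε) (by
        filter_upwards [(hR.tendsto_distHat.sub hquot).eventually_const_lt (u := ε)
          (by simpa using hlt)] with q hq hmem
        have h1 : R.distHat q.1 q.2 < ε + R.qHat c α q.1 q.2 / √(R.total q.1) := hmem
        linarith)
      rw [h0.limsup_eq]
      exact hα₀.le
  · have h0 := tendsto_measureReal_zero_of_inProb (μ := μ)
      (A := fun ν => (R.rejects c α ε ν)ᶜ) (by
        filter_upwards [(hR.tendsto_distHat.sub hquot).eventually_lt_const (u := ε)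
          (by simpa using hlt)] with q hq hmem
        refine hmem ?_
        change R.distHat q.1 q.2 < ε + R.qHat c α q.1 q.2 / √(R.total q.1)
        linarith)
    have h1 : Tendsto (fun ν => μ.real (R.rejects c α ε ν)) atTop (𝓝 1) := by
      have h2 := h0.const_sub 1
      rw [sub_zero] at h2
      exact tendsto_of_tendsto_of_tendsto_of_le_of_le h2 tendsto_const_nhds
        (fun ν => one_sub_measureReal_compl_le μ _) fun ν => measureReal_le_one
    exact h1.liminf_eq

end
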